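/- A \emph{problem} $\mathsf P$ is a partial multifunction $\omega^\omega\rightrightarrows\omega^\omega$; the elements of $\operatorname{dom}(\mathsf P)$ are its instances and the elements of $\mathsf P(f)$ are the solutions to the instance $f$. Write $\mathsf Q\le_{\mathrm{sW}}\mathsf P$ if there are Turing functionals $\Phi,\Psi$ such that for every $f\in\operatorname{dom}(\mathsf Q)$ we have $\Phi(f)\in\operatorname{dom}(\mathsf P)$ and $\Psi(\widehat g)\in\mathsf Q(f)$ for every $\widehat g\in\mathsf P(\Phi(f))$; write $\mathsf Q\equiv_{\mathrm{sW}}\mathsf P$ if $\mathsf Q\le_{\mathrm{sW}}\mathsf P$ and $\mathsf P\le_{\mathrm{sW}}\mathsf Q$. A number $x\in\omega$ is identified with the sequence $x,0,0,\dots\in\omega^\omega$, Turing functionals are given by their indices, and $\langle\cdot,\dots,\cdot\rangle$ denotes the join of finitely many elements of $\omega^\omega$; when the number of joined objects is not fixed, it is computable from the join. The \emph{first-order part} ${}^1\mathsf P$ has as instances all triples $\langle f,\Phi,\Psi\rangle$ of an $f\in\omega^\omega$ and Turing functionals $\Phi,\Psi$ such that $\Phi(f)\in\operatorname{dom}(\mathsf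 P)$ and $\Psi(f,g)(0)$ converges for all $g\in\mathsf P(\Phi(f))$; its solutions are the numbers $\Psi(f,g)(0)$ with $g\in\mathsf P(\Phi(f))$. The \emph{jump} $\mathsf P'$ has as instances all pairs $\langle f,i\rangle$ such that $i$ is a $\Delta^{0,f}_2$ index of an instance $g$ of $\mathsf P$ (that is, $g$ is computed by the $i$-th Turing functional from the Turing jump of $f$), with solutions all $\mathsf P$-solutions to $g$; $\mathsf P^{(0)}=\mathsf P$ and $\mathsf P^{(n+1)}=(\mathsf P^{(n)})'$. The \emph{finite parallelization} $\mathsf P^*$ has as instances all $\langle k,\langle f_0,\dots,f_{k-1}\rangle\rangle$ with $k\ge 1$ and $f_0,\dots,f_{k-1}\in\operatorname{dom}(\mathsf P)$, with solutions all $\langle g_0,\dots,g_{k-1}\rangle$ with $g_i\in\mathsf P(f_i)$ for all $i<k$. $\mathsf C_2$ is the problem whose instances are the enumerations of proper subsets of $\{0,1\}$, given as functions $v:\omega\to\{0,1,2\}$ such that $\{0,1\}\nsubseteq\operatorname{ran}(v)$, such that $v(t)\ne 2$ whenever $v(s)\neq v(t)$ for some $s<t$, and such that $v(u)=v(s)$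 whenever $s<u<t$ and $v(s)=v(t)$; its solutions are the $i\in\{0,1\}$ not in $\operatorname{ran}(v)$. $\mathsf{WKL}$ is the problem whose instances are the infinite trees $T\subseteq 2^{<\omega}$, with solutions the infinite paths through $T$, and $\mathsf{WWKL}$ is its restriction to the trees $T$ whose set of paths $[T]\subseteq 2^\omega$ has positive Lebesgue measure. \textbf{Theorem.} For all $n\in\omega$, \[ {}^1(\mathsf{WWKL}^{(n)})\equiv_{\mathrm{sW}}{}^1(\mathsf{WKL}^{(n)})\equiv_{\mathrm{sW}}(\mathsf C_2^*)^{(n)}. \] -/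

import Mathlib

noncomputable section

namespace Weihrauch

/-! ### Baire space, joins, tuples -/

/-- Baire space `ω^ω`. -/
abbrev Baire : Type := ℕ → ℕ

/-- The embedding of `ω` into `ω^ω`: the number `x` becomes the sequence `x, 0, 0, 0, …`. -/
def ofNat (x : ℕ) : Baire := fun n => if n = 0 then x else 0

/-- The Turing join `⟨f, g⟩`: `f` on the even positions and `g` on the odd positions. -/
def join (f g : Baire) : Baire := fun n => if n % 2 = 0 then f (n / 2) else g (n / 2)

/-- The join `⟨F 0, …, F (k - 1)⟩` of finitely many sequences, from which the number `k` of
sequences can be read off: position `0` holds `k`, and position `⟨i, x⟩ + 1` holds `F i x`. -/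
def tuple (k : ℕ) (F : Fin k → Baire) : Baire
  | 0 => k
  | n + 1 => if h : n.unpair.1 < k then F ⟨n.unpair.1, h⟩ n.unpair.2 else 0

/-- The finite initial segment `f ↾ k` of `f`. -/
def initSeg {α : Type} (f : ℕ → α) (k : ℕ) : List α := (List.range k).map f

/-! ### Turing functionals -/

/-- The oracle computation `Φ_e^f(x)`, where `Φ_0, Φ_1, …` is a computable listing of all Turing
functionals. The `e`-th program is a partial recursive function of a finite piece of oracle
information `σ` and of the input `x`. The computation `Φ_e^f(x)` goes through the stages
`k = ⟨s, t⟩ = 0, 1, 2, …`; in stage `⟨s, t⟩` it runs the `e`-th program with time bound `s` on the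
initial segment `f ↾ t` of the oracle and the input `x`, and it halts with the output of that
program in the first stage, if any, in which the program halts. -/
def Phi (e : ℕ) (f : Baire) (x : ℕ) : Part ℕ :=
  Nat.rfindOpt fun k =>
    Nat.Partrec.Code.evaln k.unpair.1 (Denumerable.ofNat Nat.Partrec.Code e)
      (Nat.pair (Encodable.encode (initSeg f k.unpair.2)) x)

/-- `Φ_e(f) = g`, that is, `Φ_e^f(x)` converges to `g x` for every `x`. -/
def Computes (e : ℕ) (f g : Baire) : Prop := ∀ x, g x ∈ Phi e f x

open Classical in
/-- The Turing jump `f'`, the characteristic function of `{e | Φ_e^f(e) converges}`. -/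
def turingJump (f : Baire) : Baire := fun e => if (Phi e f e).Dom then 1 else 0

/-- `i` is a `Δ^{0,f}_2` index of `g`: the function `g` is computed by `Φ_i` from `f'`. -/
def IsDelta2Index (f : Baire) (i : ℕ) (g : Baire) : Prop := Computes i (turingJump f) g

/-! ### Problems and strong Weihrauch reducibility -/

/-- A problem: a partial multifunction from `ω^ω` to `ω^ω`, given by its domain (the instances)
and by the set of solutions of each instance. The value of `sol` outside `dom` plays no role. -/
structure Problem where
  dom : Set Baire
  sol : Baire → Set Baire

/-- `Q` is strongly Weihrauch reducible to `P`. -/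
def StrongReducible (Q P : Problem) : Prop :=
  ∃ a b : ℕ, ∀ f ∈ Q.dom, ∃ h ∈ P.dom, Computes a f h ∧
    ∀ p ∈ P.sol h, ∃ q ∈ Q.sol f, Computes b p q

/-- `Q` and `P` are strongly Weihrauch equivalent. -/
def StrongEquiv (Q P : Problem) : Prop := StrongReducible Q P ∧ StrongReducible P Q

namespace Problem

/-- The finite parallelization `P^*`: given `k ≥ 1` instances of `P`, solve all of them. -/
def finitePar (P : Problem) : Problem where
  dom := {q | ∃ (k : ℕ) (F : Fin k → Baire), 1 ≤ k ∧ (∀ i, F i ∈ P.dom) ∧ q = tuple k F}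
  sol q := {r | ∃ (k : ℕ) (F G : Fin k → Baire),
    q = tuple k F ∧ r = tuple k G ∧ ∀ i, G i ∈ P.sol (F i)}

/-- The jump `P'`: the instances are the pairs `⟨f, i⟩` where `i` is a `Δ^{0,f}_2` index of an
instance `g` of `P`; the solutions are the `P`-solutions of `g`. -/
def jump (P : Problem) : Problem where
  dom := {q | ∃ f i g, q = join f (ofNat i) ∧ IsDelta2Index f i g ∧ g ∈ P.dom}
  sol q := {p | ∃ f i g, q = join f (ofNat i) ∧ IsDelta2Index f i g ∧ p ∈ P.sol g}

/-- The iterated jump `P^(n)`. -/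
def iterJump (P : Problem) : ℕ → Problem
  | 0 => P
  | n + 1 => (P.iterJump n).jump

/-- The first-order part `¹P`: the instances are the triples `⟨f, Φ, Ψ⟩`, with the functionals
given by indices, such that `Φ(f)` is an instance of `P` and `Ψ(f, g)(0)` converges for every
`P`-solution `g` of `Φ(f)`; the solutions are the numbers `Ψ(f, g)(0)` for such `g`. -/
def firstOrderPart (P : Problem) : Problem where
  dom := {q | ∃ f a b h, q = join f (join (ofNat a) (ofNat b)) ∧ Computes a f h ∧ h ∈ P.dom ∧
    ∀ g ∈ P.sol h, (Phi b (join f g) 0).Dom}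
  sol q := {r | ∃ f a b h, q = join f (join (ofNat a) (ofNat b)) ∧ Computes a f h ∧
    ∃ g ∈ P.sol h, ∃ y ∈ Phi b (join f g) 0, r = ofNat y}

end Problem

/-! ### Choice, weak König's lemma and weak weak König's lemma -/

/-- The choice problem `C_k`. An instance is an enumeration `v : ω → k + 1` of a proper subset of
`k = {0, …, k - 1}`, where the value `k` stands for "nothing enumerated so far", a new value is
taken only when a new element is enumerated, and every value is kept until then. The solutions are
the `i < k` which are not enumerated. -/
def choice (k : ℕ) : Problem where
  dom := {v | (∀ s, v s ≤ k) ∧ (∃ i < k, ∀ s, v s ≠ i) ∧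
    (∀ s t, s < t → v s ≠ v t → v t ≠ k) ∧
    (∀ s t, s < t → v s = v t → ∀ u, s < u → u < t → v u = v s)}
  sol v := {r | ∃ i < k, (∀ s, v s ≠ i) ∧ r = ofNat i}

/-- A tree `T ⊆ 2^{<ω}`: a set of binary strings closed under initial segments. -/
def IsTree (T : Set (List Bool)) : Prop := ∀ σ ∈ T, ∀ τ, τ <+: σ → τ ∈ T

/-- The set `[T] ⊆ 2^ω` of infinite paths through `T`. -/
def paths (T : Set (List Bool)) : Set (ℕ → Bool) := {x | ∀ n, initSeg x n ∈ T}

open Classical in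
/-- A set of binary strings as an element of Baire space, namely the characteristic function of the
set of the codes of its elements. -/
def codeSet (T : Set (List Bool)) : Baire :=
  fun n => if ∃ σ ∈ T, Encodable.encode σ = n then 1 else 0

/-- Lebesgue measure on Cantor space `2^ω`: the product of the uniform measures on `{0, 1}`. -/
def cantorMeasure : MeasureTheory.Measure (ℕ → Bool) :=
  MeasureTheory.Measure.infinitePi fun _ : ℕ => (PMF.uniformOfFintype Bool).toMeasure

/-- Weak König's lemma: given an infinite tree `T ⊆ 2^{<ω}`, find a path through `T`. -/
def WKL : Problem where
  dom := {t | ∃ T, IsTree T ∧ T.Infinite ∧ t = codeSet T}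
  sol t := {p | ∃ T, t = codeSet T ∧ ∃ x ∈ paths T, p = fun n => (x n).toNat}

/-- Weak weak König's lemma: `WKL` restricted to the trees `T` such that `[T]` has positive
measure. -/
def WWKL : Problem where
  dom := {t | ∃ T, IsTree T ∧ T.Infinite ∧ 0 < cantorMeasure (paths T) ∧ t = codeSet T}
  sol := WKL.sol

end Weihrauch

end

/-! The proof is a cycle of reductions: from `(C_2^*)^(n)` to the first-order part of `WWKL^(n)`,
from there to that of `WKL^(n)`, and back. The middle step holds because `WWKL` restricts the
instances of `WKL` and keeps the solutions.

For the first step, finitely many bits fit into one number, so `C_2^*` reduces to the number-valued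
problem `codedChoice`. That problem reduces to `WWKL`: for a `k`-tuple of enumerations take the tree
whose paths begin with `1^k 0 b_0 … b_{k-1}`, where `b_i` is never enumerated by the `i`-th
component. Later bits are free, so the paths contain a cylinder and have positive measure. Strong
reductions pass to jumps (`StrongReducible.jump`), and a number-valued problem that reduces to `P`
reduces to the first-order part of `P` (`StrongReducible.firstOrderPart`).

For the last step, the first-order part is replaced by `Problem.observation`, where the instance of
`P` is given explicitly. Since the jump of `⟨f, g⟩` uniformly computes `f` and the jump of `g`, the
observation of a jump reduces to the jump of the observation (`observation_jump_reducible`), which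
leaves the case `n = 0` (`observation_WKL_reducible`). By compactness there is an `m` such that
`Φ_b(f, x)(0)` is decided by `x ↾ m` for all paths `x`. For each of finitely many strings, an
instance of `C_2` asks for a bit that keeps an extendible string extendible. The answers lead to a
string of length `m` on a path, hence to a value of the observation. The backward functional does
not see `f` and `b`, so the number of instances in the tuple is chosen to code `b` and `f ↾ m`. -/

namespace Weihrauch

/-! ### Primitive recursive functions -/

section Primrec

variable {α β γ σ : Type*} [Primcodable α] [Primcodable β] [Primcodable γ] [Primcodable σ]

attribute [fun_prop] Primrec

@[fun_prop] theorem primrec_id : Primrec (fun a : α => a) := Primrec.id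

@[fun_prop] theorem primrec_const (b : β) : Primrec (fun _ : α => b) := Primrec.const b

@[fun_prop] theorem primrec_comp {f : β → γ} {g : α → β} (hf : Primrec f) (hg : Primrec g) :
    Primrec (fun a => f (g a)) := hf.comp hg

@[fun_prop] theorem primrec_prodMk {f : α → β} {g : α → γ} (hf : Primrec f) (hg : Primrec g) :
    Primrec (fun a => (f a, g a)) := hf.pair hg

@[fun_prop] theorem primrec_fst {f : α → β × γ} (hf : Primrec f) :
    Primrec (fun a => (f a).1) := Primrec.fst.comp hf

@[fun_prop] theorem primrec_snd {f : α → β × γ} (hf : Primrec f) :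
    Primrec (fun a => (f a).2) := Primrec.snd.comp hf

@[fun_prop] theorem primrec_succ {f : α → ℕ} (hf : Primrec f) :
    Primrec (fun a => Nat.succ (f a)) := Primrec.succ.comp hf

@[fun_prop] theorem primrec_add {f g : α → ℕ} (hf : Primrec f) (hg : Primrec g) :
    Primrec (fun a => f a + g a) := Primrec.nat_add.comp hf hg

@[fun_prop] theorem primrec_mul {f g : α → ℕ} (hf : Primrec f) (hg : Primrec g) :
    Primrec (fun a => f a * g a) := Primrec.nat_mul.comp hf hg

@[fun_prop] theorem primrec_sub {f g : α → ℕ} (hf : Primrec f) (hg : Primrec g) :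
    Primrec (fun a => f a - g a) := Primrec.nat_sub.comp hf hg

@[fun_prop] theorem primrec_div {f g : α → ℕ} (hf : Primrec f) (hg : Primrec g) :
    Primrec (fun a => f a / g a) := Primrec.nat_div.comp hf hg

@[fun_prop] theorem primrec_mod {f g : α → ℕ} (hf : Primrec f) (hg : Primrec g) :
    Primrec (fun a => f a % g a) := Primrec.nat_mod.comp hf hg

@[fun_prop] theorem primrec_natPair {f g : α → ℕ} (hf : Primrec f) (hg : Primrec g) :
    Primrec (fun a => Nat.pair (f a) (g a)) := Primrec₂.natPair.comp hf hg

@[fun_prop] theorem primrec_unpair {f : α → ℕ} (hf : Primrec f) :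
    Primrec (fun a => Nat.unpair (f a)) := Primrec.unpair.comp hf

@[fun_prop] theorem primrec_beq [DecidableEq β] {f g : α → β} (hf : Primrec f) (hg : Primrec g) :
    Primrec (fun a => f a == g a) := Primrec.beq.comp hf hg

@[fun_prop] theorem primrec_decide_lt {f g : α → ℕ} (hf : Primrec f) (hg : Primrec g) :
    Primrec (fun a => decide (f a < g a)) := Primrec.nat_lt.decide.comp hf hg

@[fun_prop] theorem primrec_and {f g : α → Bool} (hf : Primrec f) (hg : Primrec g) :
    Primrec (fun a => f a && g a) := Primrec.and.comp hf hg

@[fun_prop] theorem primrec_or {f g : α → Bool} (hf : Primrec f) (hg : Primrec g) :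
    Primrec (fun a => f a || g a) := Primrec.or.comp hf hg

@[fun_prop] theorem primrec_not {f : α → Bool} (hf : Primrec f) :
    Primrec (fun a => !f a) := Primrec.not.comp hf

@[fun_prop] theorem primrec_toNat {f : α → Bool} (hf : Primrec f) :
    Primrec (fun a => (f a).toNat) := (Primrec.dom_finite Bool.toNat).comp hf

@[fun_prop] theorem primrec_cond {c : α → Bool} {f g : α → β} (hc : Primrec c)
    (hf : Primrec f) (hg : Primrec g) :
    Primrec (fun a => bif c a then f a else g a) := Primrec.cond hc hf hg

@[fun_prop] theorem primrec_natRec {f : α → ℕ} {g : α → β} {h : α → ℕ → β → β}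
    (hf : Primrec f) (hg : Primrec g)
    (hh : Primrec (fun p : α × ℕ × β => h p.1 p.2.1 p.2.2)) :
    Primrec (fun a => Nat.rec (motive := fun _ => β) (g a) (h a) (f a)) :=
  Primrec.nat_rec' (h := fun a p => h a p.1 p.2) hf hg hh

@[fun_prop] theorem primrec_some {f : α → β} (hf : Primrec f) :
    Primrec (fun a => some (f a)) := Primrec.option_some.comp hf

@[fun_prop] theorem primrec_optionBind {f : α → Option β} {g : α → β → Option γ}
    (hf : Primrec f) (hg : Primrec (fun p : α × β => g p.1 p.2)) :
    Primrec (fun a => (f a).bind (g a)) := Primrec.option_bind hf hg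

@[fun_prop] theorem primrec_optionMap {f : α → Option β} {g : α → β → γ}
    (hf : Primrec f) (hg : Primrec (fun p : α × β => g p.1 p.2)) :
    Primrec (fun a => (f a).map (g a)) := Primrec.option_map hf hg

@[fun_prop] theorem primrec_optionOr {f g : α → Option β} (hf : Primrec f) (hg : Primrec g) :
    Primrec (fun a => (f a).or (g a)) :=
  (Primrec.option_orElse.comp hf hg).of_eq fun a => by cases f a <;> rfl

@[fun_prop] theorem primrec_optionGetD {f : α → Option β} {g : α → β}
    (hf : Primrec f) (hg : Primrec g) :
    Primrec (fun a => (f a).getD (g a)) := Primrec.option_getD.comp hf hg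

@[fun_prop] theorem primrec_isSome {f : α → Option β} (hf : Primrec f) :
    Primrec (fun a => (f a).isSome) := Primrec.option_isSome.comp hf

@[fun_prop] theorem primrec_encode {f : α → β} (hf : Primrec f) :
    Primrec (fun a => Encodable.encode (f a)) := Primrec.encode.comp hf

@[fun_prop] theorem primrec_decode {f : α → ℕ} (hf : Primrec f) :
    Primrec (fun a => (Encodable.decode (f a) : Option β)) := Primrec.decode.comp hf

@[fun_prop] theorem primrec_cons {f : α → β} {g : α → List β}
    (hf : Primrec f) (hg : Primrec g) :
    Primrec (fun a => f a :: g a) := Primrec.list_cons.comp hf hg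

@[fun_prop] theorem primrec_append {f g : α → List β}
    (hf : Primrec f) (hg : Primrec g) :
    Primrec (fun a => f a ++ g a) := Primrec.list_append.comp hf hg

@[fun_prop] theorem primrec_length {f : α → List β} (hf : Primrec f) :
    Primrec (fun a => (f a).length) := Primrec.list_length.comp hf

@[fun_prop] theorem primrec_getElem? {f : α → List β} {g : α → ℕ}
    (hf : Primrec f) (hg : Primrec g) :
    Primrec (fun a => (f a)[g a]?) := Primrec.list_getElem?.comp hf hg

@[fun_prop] theorem primrec_getD {f : α → List β} {g : α → ℕ} {d : β}
    (hf : Primrec f) (hg : Primrec g) :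
    Primrec (fun a => (f a).getD (g a) d) := (Primrec.list_getD d).comp hf hg

@[fun_prop] theorem primrec_take {f : α → List β} {g : α → ℕ}
    (hf : Primrec f) (hg : Primrec g) :
    Primrec (fun a => (f a).take (g a)) := Primrec.list_take.comp hg hf

@[fun_prop] theorem primrec_range {f : α → ℕ} (hf : Primrec f) :
    Primrec (fun a => List.range (f a)) := Primrec.list_range.comp hf

@[fun_prop] theorem primrec_map {f : α → List β} {g : α → β → γ} (hf : Primrec f)
    (hg : Primrec (fun p : α × β => g p.1 p.2)) :
    Primrec (fun a => (f a).map (g a)) := Primrec.list_map hf hg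

@[fun_prop] theorem primrec_flatMap {f : α → List β} {g : α → β → List γ} (hf : Primrec f)
    (hg : Primrec (fun p : α × β => g p.1 p.2)) :
    Primrec (fun a => (f a).flatMap (g a)) := Primrec.list_flatMap hf hg

@[fun_prop] theorem primrec_all {f : α → List β} {g : α → β → Bool} (hf : Primrec f)
    (hg : Primrec (fun p : α × β => g p.1 p.2)) :
    Primrec (fun a => (f a).all (g a)) := by
  have h : Primrec fun a => (f a).foldr (fun b r => g a b && r) true :=
    Primrec.list_foldr (h := fun a p => g a p.1 && p.2) hf (.const true)
      (show Primrec fun p : α × β × Bool => g p.1 p.2.1 && p.2.2 by fun_prop)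
  refine h.of_eq fun a => ?_
  induction f a with
  | nil => rfl
  | cons b l ih => rw [List.foldr_cons, ih, List.all_cons]

@[fun_prop] theorem primrec_findIdx {f : α → List β} {g : α → β → Bool} (hf : Primrec f)
    (hg : Primrec (fun p : α × β => g p.1 p.2)) :
    Primrec (fun a => (f a).findIdx (g a)) := Primrec.list_findIdx hf hg

@[fun_prop] theorem primrec_evaln {k c n : α → ℕ} (hk : Primrec k) (hc : Primrec c)
    (hn : Primrec n) :
    Primrec (fun a => Nat.Partrec.Code.evaln (k a)
      (Denumerable.ofNat Nat.Partrec.Code (c a)) (n a)) :=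
  Nat.Partrec.Code.primrec_evaln.comp ((hk.pair ((Primrec.ofNat _).comp hc)).pair hn)

end Primrec

/-! ### Initial segments -/

section InitSeg

variable {α β : Type}

@[simp] theorem length_initSeg (f : ℕ → α) (t : ℕ) : (initSeg f t).length = t := by
  simp [initSeg]

theorem getElem?_initSeg (f : ℕ → α) {t n : ℕ} (h : n < t) : (initSeg f t)[n]? = some (f n) := by
  simp [initSeg, h]

theorem getElem?_initSeg_eq_some {f : ℕ → α} {t n : ℕ} {y : α} :
    (initSeg f t)[n]? = some y ↔ n < t ∧ f n = y := by
  by_cases h : n < t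
  · rw [getElem?_initSeg f h]
    simp [h]
  · simp [h]

theorem getD_initSeg (f : ℕ → α) {t n : ℕ} (d : α) (h : n < t) : (initSeg f t).getD n d = f n := by
  simp [initSeg, h]

theorem take_initSeg (f : ℕ → α) {t n : ℕ} (h : n ≤ t) : (initSeg f t).take n = initSeg f n := by
  simp [initSeg, ← List.map_take, List.take_range, h]

theorem initSeg_succ (f : ℕ → α) (t : ℕ) : initSeg f (t + 1) = initSeg f t ++ [f t] := by
  simp [initSeg, List.range_succ]

theorem initSeg_getD (l : List α) (d : α) : initSeg (fun n => l.getD n d) l.length = l := by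
  refine List.ext_getElem (by simp) fun n h1 h2 => ?_
  simp [initSeg, h2]

theorem initSeg_prefix (f : ℕ → α) {s t : ℕ} (h : s ≤ t) : initSeg f s <+: initSeg f t := by
  rw [← take_initSeg f h]
  exact List.take_prefix _ _

end InitSeg

/-! ### Finite approximations of Turing functionals -/

/-- The first value among `S 0, …, S (L - 1)`. -/
def firstSome {α : Type} (S : ℕ → Option α) (L : ℕ) : Option α :=
  Nat.rec (motive := fun _ => Option α) none (fun k r => r.or (S k)) L

@[fun_prop] theorem primrec_firstSome {α : Type*} {β : Type} [Primcodable α] [Primcodable β]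
    {S : α → ℕ → Option β} {L : α → ℕ}
    (hS : Primrec (fun p : α × ℕ => S p.1 p.2)) (hL : Primrec L) :
    Primrec (fun a => firstSome (S a) (L a)) := by
  unfold firstSome
  have : Primrec (fun p : α × ℕ × Option β => S p.1 p.2.1) :=
    hS.comp (Primrec.fst.pair (Primrec.fst.comp Primrec.snd))
  fun_prop

theorem firstSome_eq_none {α : Type} {S : ℕ → Option α} {L : ℕ} :
    firstSome S L = none ↔ ∀ k < L, S k = none := by
  induction L with
  | zero => simp [firstSome]
  | succ L ih =>
    have : firstSome S (L + 1) = (firstSome S L).or (S L) := rfl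
    rw [this, Option.or_eq_none_iff, ih]
    refine ⟨fun h k hk => ?_, fun h => ⟨fun k hk => h k (by omega), h L (by omega)⟩⟩
    rcases Nat.lt_succ_iff_lt_or_eq.1 hk with hk | rfl
    exacts [h.1 k hk, h.2]

theorem firstSome_eq_some {α : Type} {S : ℕ → Option α} {L : ℕ} {y : α} :
    firstSome S L = some y ↔ ∃ k < L, S k = some y ∧ ∀ j < k, S j = none := by
  induction L with
  | zero => simp [firstSome]
  | succ L ih =>
    have : firstSome S (L + 1) = (firstSome S L).or (S L) := rfl
    rw [this, Option.or_eq_some_iff, ih, firstSome_eq_none]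
    constructor
    · rintro (⟨k, hk, h⟩ | h)
      exacts [⟨k, by omega, h⟩, ⟨L, by omega, h.2, h.1⟩]
    · rintro ⟨k, hk, h⟩
      rcases Nat.lt_succ_iff_lt_or_eq.1 hk with hk | rfl
      exacts [Or.inl ⟨k, hk, h⟩, Or.inr ⟨h.2, h.1⟩]

theorem firstSome_congr {α : Type} {S S' : ℕ → Option α} {L : ℕ} (h : ∀ k < L, S k = S' k) :
    firstSome S L = firstSome S' L := by
  induction L with
  | zero => rfl
  | succ L ih =>
    show (firstSome S L).or (S L) = (firstSome S' L).or (S' L)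
    rw [ih fun k hk => h k (by omega), h L (by omega)]

theorem mem_rfindOpt_iff {α : Type} {S : ℕ → Option α} {y : α} :
    y ∈ Nat.rfindOpt S ↔ ∃ k, S k = some y ∧ ∀ j < k, S j = none := by
  unfold Nat.rfindOpt
  rw [Part.mem_bind_iff]
  constructor
  · rintro ⟨k, h, h3⟩
    refine ⟨k, by simpa using h3, fun j hj => ?_⟩
    simpa using (Nat.mem_rfind.1 h).2 hj
  · rintro ⟨k, h1, h2⟩
    exact ⟨k, Nat.mem_rfind.2 ⟨by simp [h1], fun {j} hj => by simp [h2 j hj]⟩, by simp [h1]⟩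

/-- The `k`-th stage of the computation of `Φ_e` on the oracle information `σ` and the input `x`. -/
def stage (e : ℕ) (σ : List ℕ) (x k : ℕ) : Option ℕ :=
  Nat.Partrec.Code.evaln k.unpair.1 (Denumerable.ofNat Nat.Partrec.Code e)
    (Nat.pair (Encodable.encode (σ.take k.unpair.2)) x)

/-- The result of the computation of `Φ_e` on the input `x` after as many stages as the oracle
information `σ` is long. -/
def approx (e : ℕ) (σ : List ℕ) (x : ℕ) : Option ℕ := firstSome (stage e σ x) σ.length

@[fun_prop] theorem primrec_approx {α : Type*} [Primcodable α] {e x : α → ℕ} {σ : α → List ℕ}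
    (he : Primrec e) (hσ : Primrec σ) (hx : Primrec x) :
    Primrec (fun a => approx (e a) (σ a) (x a)) := by
  have : Primrec (fun p : ℕ × List ℕ × ℕ => approx p.1 p.2.1 p.2.2) := by
    unfold approx stage
    fun_prop
  exact this.comp (he.pair (hσ.pair hx))

/-- Stage `k = ⟨s, t⟩` consults only `f ↾ t`, and `t ≤ k`. Hence an initial segment of length `L`
suffices to run the first `L` stages, and `approx` sees the true computation. -/
theorem mem_Phi_iff {e x y : ℕ} {f : Baire} :
    y ∈ Phi e f x ↔ ∃ t, approx e (initSeg f t) x = some y := by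
  have key : ∀ t, approx e (initSeg f t) x = firstSome (fun k =>
      Nat.Partrec.Code.evaln k.unpair.1 (Denumerable.ofNat Nat.Partrec.Code e)
      (Nat.pair (Encodable.encode (initSeg f k.unpair.2)) x)) t := by
    intro t
    unfold approx
    rw [length_initSeg]
    refine firstSome_congr fun k hk => ?_
    rw [stage, take_initSeg f ((Nat.unpair_right_le k).trans hk.le)]
  simp only [key, firstSome_eq_some]
  unfold Phi
  rw [mem_rfindOpt_iff]
  constructor
  · rintro ⟨k, h⟩
    exact ⟨k + 1, k, by omega, h⟩
  · rintro ⟨t, k, -, h⟩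
    exact ⟨k, h⟩

theorem approx_mono {e x y : ℕ} {σ τ : List ℕ} (h : σ <+: τ) (hy : approx e σ x = some y) :
    approx e τ x = some y := by
  unfold approx at *
  rw [firstSome_eq_some] at *
  obtain ⟨k, hk, h1, h2⟩ := hy
  have key : ∀ j < σ.length, stage e τ x j = stage e σ x j := by
    intro j hj
    obtain ⟨ρ, rfl⟩ := h
    rw [stage, stage, List.take_append_of_le_length ((Nat.unpair_right_le j).trans hj.le)]
  exact ⟨k, hk.trans_le h.length_le, by rw [key k hk, h1],
    fun j hj => by rw [key j (hj.trans hk), h2 j hj]⟩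

theorem approx_initSeg_mono {e x y s t : ℕ} {f : Baire} (h : s ≤ t)
    (hy : approx e (initSeg f s) x = some y) : approx e (initSeg f t) x = some y :=
  approx_mono (initSeg_prefix f h) hy

theorem Phi_dom_iff {e x : ℕ} {f : Baire} :
    (Phi e f x).Dom ↔ ∃ t, approx e (initSeg f t) x ≠ none := by
  rw [Part.dom_iff_mem]
  simp only [mem_Phi_iff, Option.ne_none_iff_exists']
  exact exists_comm

/-- A primitive recursive function of a parameter, finite oracle information and an input
determines Turing functionals, with an index computable from the parameter. -/
theorem exists_index {α : Type} [Primcodable α] (φ : α → List ℕ → ℕ → Option ℕ)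
    (hφ : Primrec (fun p : α × List ℕ × ℕ => φ p.1 p.2.1 p.2.2)) :
    ∃ s : α → ℕ, Primrec s ∧ ∀ a f x,
      (∀ y ∈ Phi (s a) f x, ∃ t, φ a (initSeg f t) x = some y) ∧
      ((∃ t, φ a (initSeg f t) x ≠ none) → (Phi (s a) f x).Dom) := by
  let ψ : ℕ → Option ℕ := fun m =>
    (Encodable.decode (α := α) m.unpair.1).bind fun a =>
      (Encodable.decode (α := List ℕ) m.unpair.2.unpair.1).bind fun σ => φ a σ m.unpair.2.unpair.2
  have hψ : Primrec ψ := by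
    have h1 : Primrec fun q : (ℕ × α) × List ℕ => φ q.1.2 q.2 q.1.1.unpair.2.unpair.2 := by
      have : Primrec fun q : (ℕ × α) × List ℕ => (q.1.2, q.2, q.1.1.unpair.2.unpair.2) := by
        fun_prop
      exact hφ.comp this
    fun_prop
  have hp : Nat.Partrec (fun m => (ψ m : Part ℕ) : ℕ →. ℕ) :=
    Partrec.nat_iff.1 hψ.to_comp.ofOption
  obtain ⟨c, hc⟩ := Nat.Partrec.Code.exists_code.1 hp
  -- The s-m-n theorem: currying hard-wires the parameter into the program.
  refine ⟨fun a => Encodable.encode (Nat.Partrec.Code.curry c (Encodable.encode a)), ?_, ?_⟩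
  · exact Primrec.encode.comp (Nat.Partrec.Code.primrec₂_curry.comp (.const c) .encode)
  · intro a f x
    have hev : ∀ t y, y ∈ Nat.Partrec.Code.eval (Nat.Partrec.Code.curry c (Encodable.encode a))
        (Nat.pair (Encodable.encode (initSeg f t)) x) ↔ φ a (initSeg f t) x = some y := by
      intro t y
      rw [Nat.Partrec.Code.eval_curry, hc]
      simp [ψ]
    simp only [Phi, Denumerable.ofNat_encode]
    constructor
    · intro y hy
      obtain ⟨k, hk⟩ := Nat.rfindOpt_spec hy
      exact ⟨k.unpair.2, (hev _ _).1 (Nat.Partrec.Code.evaln_sound hk)⟩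
    · rintro ⟨t, ht⟩
      obtain ⟨y, hy⟩ := Option.ne_none_iff_exists'.1 ht
      obtain ⟨s, hs⟩ := Nat.Partrec.Code.evaln_complete.1 ((hev _ _).2 hy)
      exact Nat.rfindOpt_dom.2 ⟨Nat.pair s t, y, by simpa using hs⟩

/-- No monotonicity of `φ` in the oracle string is needed: every value it ever returns is correct,
so it does not matter which stage is found first. -/
theorem exists_index_computes {α : Type} [Primcodable α] (φ : α → List ℕ → ℕ → Option ℕ)
    (hφ : Primrec (fun p : α × List ℕ × ℕ => φ p.1 p.2.1 p.2.2)) :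
    ∃ s : α → ℕ, Primrec s ∧ ∀ a f g, (∀ x t y, φ a (initSeg f t) x = some y → y = g x) →
      (∀ x, ∃ t, φ a (initSeg f t) x ≠ none) → Computes (s a) f g := by
  obtain ⟨s, hs, h⟩ := exists_index φ hφ
  refine ⟨s, hs, fun a f g h1 h2 x => ?_⟩
  obtain ⟨y, hy⟩ := Part.dom_iff_mem.1 ((h a f x).2 (h2 x))
  obtain ⟨t, ht⟩ := (h a f x).1 y hy
  rwa [← h1 x t y ht]

/-- A total functional with a computable bound on the amount of oracle information used. -/
theorem exists_index_of_bound (V : List ℕ → ℕ → ℕ) (u : ℕ → ℕ)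
    (hV : Primrec (fun p : List ℕ × ℕ => V p.1 p.2)) (hu : Primrec u) :
    ∃ e, ∀ f g, (∀ x t, u x < t → V (initSeg f t) x = g x) → Computes e f g := by
  obtain ⟨s, -, hs⟩ := exists_index_computes (α := Unit)
    (fun _ σ x => bif decide (u x < σ.length) then some (V σ x) else none) (by fun_prop)
  refine ⟨s (), fun f g h => hs () f g (fun x t y hy => ?_) fun x => ⟨u x + 1, ?_⟩⟩
  · by_cases ht : u x < t
    · simp [ht, h x t ht] at hy
      exact hy.symm
    · simp [ht] at hy
  · simp

theorem Computes.unique {e : ℕ} {f g h : Baire} (hg : Computes e f g) (hh : Computes e f h) :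
    g = h := funext fun x => Part.mem_unique (hg x) (hh x)

/-! ### Joins -/

theorem join_two_mul (f g : Baire) (n : ℕ) : join f g (2 * n) = f n := by
  simp [join]

theorem join_two_mul_add_one (f g : Baire) (n : ℕ) : join f g (2 * n + 1) = g n := by
  have h1 : (2 * n + 1) % 2 = 1 := by omega
  have h2 : (2 * n + 1) / 2 = n := by omega
  simp [join, h1, h2]

theorem join_inj {f g f' g' : Baire} : join f g = join f' g' ↔ f = f' ∧ g = g' := by
  refine ⟨fun h => ⟨funext fun n => ?_, funext fun n => ?_⟩, by rintro ⟨rfl, rfl⟩; rfl⟩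
  · simpa only [join_two_mul] using congrFun h (2 * n)
  · simpa only [join_two_mul_add_one] using congrFun h (2 * n + 1)

theorem ofNat_inj {x y : ℕ} : ofNat x = ofNat y ↔ x = y :=
  ⟨fun h => by simpa [ofNat] using congrFun h 0, by rintro rfl; rfl⟩

theorem ofNat_eq_cond (x n : ℕ) : ofNat x n = bif n == 0 then x else 0 := by
  simp [ofNat, Bool.cond_eq_ite]

@[fun_prop] theorem primrec_ofNat {α : Type*} [Primcodable α] {x n : α → ℕ} (hx : Primrec x)
    (hn : Primrec n) : Primrec (fun a => ofNat (x a) (n a)) := by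
  simp only [ofNat_eq_cond]
  fun_prop

/-- The entries of a list on the even positions, up to a possible last one. -/
def evens (σ : List ℕ) : List ℕ := (List.range (σ.length / 2)).map fun j => σ.getD (2 * j) 0

/-- The entries of a list on the odd positions. -/
def odds (σ : List ℕ) : List ℕ := (List.range (σ.length / 2)).map fun j => σ.getD (2 * j + 1) 0

@[fun_prop] theorem primrec_evens {α : Type*} [Primcodable α] {σ : α → List ℕ} (hσ : Primrec σ) :
    Primrec (fun a => evens (σ a)) := by
  unfold evens
  fun_prop

@[fun_prop] theorem primrec_odds {α : Type*} [Primcodable α] {σ : α → List ℕ} (hσ : Primrec σ) :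
    Primrec (fun a => odds (σ a)) := by
  unfold odds
  fun_prop

theorem evens_initSeg_join (f g : Baire) (t : ℕ) :
    evens (initSeg (join f g) t) = initSeg f (t / 2) := by
  rw [evens, length_initSeg]
  refine List.map_congr_left fun j hj => ?_
  rw [List.mem_range] at hj
  rw [getD_initSeg _ _ (by omega), join_two_mul]

theorem odds_initSeg_join (f g : Baire) (t : ℕ) :
    odds (initSeg (join f g) t) = initSeg g (t / 2) := by
  rw [odds, length_initSeg]
  refine List.map_congr_left fun j hj => ?_
  rw [List.mem_range] at hj
  rw [getD_initSeg _ _ (by omega), join_two_mul_add_one]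

/-! ### Composition of Turing functionals -/

/-- The first `n` values of `Φ_i`, as far as they can be computed from the oracle
information `σ`. -/
def approxSeg (i : ℕ) (σ : List ℕ) (n : ℕ) : Option (List ℕ) :=
  Nat.rec (motive := fun _ => Option (List ℕ)) (some [])
    (fun j r => r.bind fun l => (approx i σ j).map fun y => l ++ [y]) n

@[fun_prop] theorem primrec_approxSeg {α : Type*} [Primcodable α] {i n : α → ℕ}
    {σ : α → List ℕ} (hi : Primrec i) (hσ : Primrec σ) (hn : Primrec n) :
    Primrec (fun a => approxSeg (i a) (σ a) (n a)) := by
  unfold approxSeg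
  fun_prop

theorem approxSeg_eq {i n t : ℕ} {f g : Baire} {l : List ℕ} (h : Computes i f g)
    (hl : approxSeg i (initSeg f t) n = some l) : l = initSeg g n := by
  induction n generalizing l with
  | zero => exact (Option.some.inj hl).symm
  | succ n ih =>
    change ((approxSeg i (initSeg f t) n).bind fun l =>
      (approx i (initSeg f t) n).map fun y => l ++ [y]) = some l at hl
    simp only [Option.bind_eq_some_iff, Option.map_eq_some_iff] at hl
    obtain ⟨l', hl', y, hy, rfl⟩ := hl
    rw [ih hl', initSeg_succ, Part.mem_unique (h n) (mem_Phi_iff.2 ⟨t, hy⟩)]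

theorem exists_approxSeg_eq {i : ℕ} {f g : Baire} (h : Computes i f g) (n : ℕ) :
    ∃ t₀, ∀ t, t₀ ≤ t → approxSeg i (initSeg f t) n = some (initSeg g n) := by
  induction n with
  | zero => exact ⟨0, fun t _ => rfl⟩
  | succ n ih =>
    obtain ⟨t₀, h0⟩ := ih
    obtain ⟨t₁, h1⟩ := mem_Phi_iff.1 (h n)
    refine ⟨max t₀ t₁, fun t ht => ?_⟩
    change ((approxSeg i (initSeg f t) n).bind fun l =>
      (approx i (initSeg f t) n).map fun y => l ++ [y]) = _
    rw [h0 t (le_of_max_le_left ht), approx_initSeg_mono (le_of_max_le_right ht) h1, initSeg_succ]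
    rfl

/-- Search for an `n` such that the first `n` values of `Φ_i` suffice for the computation of `Φ_a`.
The index is computable from `i` and `a` because in a jump the index `i` is part of the instance. -/
theorem exists_comp_index : ∃ s : ℕ × ℕ → ℕ, Primrec s ∧ ∀ i a f g h,
    Computes i f g → Computes a g h → Computes (s (i, a)) f h := by
  obtain ⟨s, hs, H⟩ := exists_index_computes (α := ℕ × ℕ)
    (fun p σ x => firstSome (fun n => (approxSeg p.1 σ n).bind fun l => approx p.2 l x) σ.length)
    (by fun_prop)
  refine ⟨s, hs, fun i a f g h hi ha => H _ _ _ (fun x t y hy => ?_) fun x => ?_⟩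
  · obtain ⟨n, -, hn, -⟩ := firstSome_eq_some.1 hy
    obtain ⟨l, hl, hy⟩ := Option.bind_eq_some_iff.1 hn
    rw [approxSeg_eq hi hl] at hy
    exact Part.mem_unique (mem_Phi_iff.2 ⟨n, hy⟩) (ha x)
  · obtain ⟨n, hn⟩ := mem_Phi_iff.1 (ha x)
    obtain ⟨t₀, h0⟩ := exists_approxSeg_eq hi n
    refine ⟨max t₀ (n + 1), fun hcon => ?_⟩
    have := firstSome_eq_none.1 hcon n (by simp)
    simp [h0 _ (le_max_left _ _), hn] at this

theorem exists_id_index : ∃ e, ∀ f, Computes e f f := by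
  obtain ⟨e, he⟩ := exists_index_of_bound (fun σ x => σ.getD x 0) id (by fun_prop) (by fun_prop)
  exact ⟨e, fun f => he f f fun x t h => getD_initSeg f 0 h⟩

/-! ### Strong Weihrauch reductions -/

theorem StrongReducible.of_subset {Q P : Problem} (hd : Q.dom ⊆ P.dom)
    (hs : ∀ f ∈ Q.dom, P.sol f ⊆ Q.sol f) : StrongReducible Q P := by
  obtain ⟨e, he⟩ := exists_id_index
  exact ⟨e, e, fun f hf => ⟨f, hd hf, he f, fun p hp => ⟨p, hs f hf hp, he p⟩⟩⟩

theorem StrongReducible.trans {Q P R : Problem} (h1 : StrongReducible Q P)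
    (h2 : StrongReducible P R) : StrongReducible Q R := by
  obtain ⟨s, -, hs⟩ := exists_comp_index
  obtain ⟨a, b, h1⟩ := h1
  obtain ⟨c, d, h2⟩ := h2
  refine ⟨s (a, c), s (d, b), fun f hf => ?_⟩
  obtain ⟨g, hg, hag, h1⟩ := h1 f hf
  obtain ⟨h, hh, hch, h2⟩ := h2 g hg
  refine ⟨h, hh, hs _ _ _ _ _ hag hch, fun p hp => ?_⟩
  obtain ⟨q, hq, hdq⟩ := h2 p hp
  obtain ⟨r, hr, hbr⟩ := h1 q hq
  exact ⟨r, hr, hs _ _ _ _ _ hdq hbr⟩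

/-- The oracle `f` is kept, and the index is replaced by one for the composition with the forward
functional. The backward functional is unchanged, since it acts on solutions alone. -/
theorem StrongReducible.jump {Q P : Problem} (h : StrongReducible Q P) :
    StrongReducible Q.jump P.jump := by
  obtain ⟨s, hs, hcomp⟩ := exists_comp_index
  obtain ⟨e, he⟩ := exists_id_index
  obtain ⟨a, b, h⟩ := h
  obtain ⟨c, hc⟩ := exists_index_of_bound
    -- Position `1` of `⟨f, i⟩` is the only one that has to change: it holds the index.
    (fun σ x => bif x == 1 then s (σ.getD 1 0, a) else σ.getD x 0) (fun x => x + 1)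
    (by fun_prop) (by fun_prop)
  refine ⟨c, b, ?_⟩
  rintro _ ⟨f, i, g, rfl, hi, hg⟩
  obtain ⟨k, hk, hak, h⟩ := h g hg
  have hk' : IsDelta2Index f (s (i, a)) k := hcomp _ _ _ _ _ hi hak
  refine ⟨join f (ofNat (s (i, a))), ⟨f, _, k, rfl, hk', hk⟩, hc _ _ fun x t hxt => ?_, ?_⟩
  · rw [getD_initSeg _ _ (by omega), getD_initSeg _ _ (by omega)]
    obtain ⟨x, rfl | rfl⟩ : ∃ k, x = 2 * k ∨ x = 2 * k + 1 := ⟨x / 2, by omega⟩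
    · have : 2 * x ≠ 1 := by omega
      simp [Bool.cond_eq_ite, this, join_two_mul]
    · have this (i) : join f (ofNat i) 1 = i := by simp [join, ofNat]
      by_cases hx : x = 0 <;> simp [Bool.cond_eq_ite, join_two_mul_add_one, ofNat, this, hx]
  · rintro p ⟨f', i', k', heq, hi', hp⟩
    simp only [join_inj, ofNat_inj] at heq
    obtain ⟨rfl, rfl⟩ := heq
    rw [hi'.unique hk'] at hp
    obtain ⟨q, hq, hbq⟩ := h p hp
    exact ⟨q, ⟨f, i, g, rfl, hi, hq⟩, hbq⟩

theorem StrongReducible.iterJump {Q P : Problem} (h : StrongReducible Q P) (n : ℕ) :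
    StrongReducible (Q.iterJump n) (P.iterJump n) := by
  induction n with
  | zero => exact h
  | succ n ih => exact ih.jump

/-! ### First-order parts -/

/-- The problem whose instances consist of a sequence `f`, an index `b` of a functional and an
instance `h` of `P` such that `Φ_b(f, g)(0)` converges for every solution `g` of `h`; its solutions
are the numbers `Φ_b(f, g)(0)`. -/
def Problem.observation (P : Problem) : Problem where
  dom := {q | ∃ f b h, q = join (join f (ofNat b)) h ∧ h ∈ P.dom ∧
    ∀ g ∈ P.sol h, (Phi b (join f g) 0).Dom}
  sol q := {r | ∃ f b h, q = join (join f (ofNat b)) h ∧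
    ∃ g ∈ P.sol h, ∃ y ∈ Phi b (join f g) 0, r = ofNat y}

/-- The forward functional runs `Φ_a` itself and passes on its output. With the instance of `P`
explicit, jumps can be pulled out. -/
theorem firstOrderPart_reducible_observation (P : Problem) :
    StrongReducible P.firstOrderPart P.observation := by
  obtain ⟨e, he⟩ := exists_id_index
  obtain ⟨s, -, hs⟩ := exists_index_computes (α := Unit)
    -- In `⟨⟨f, b⟩, h⟩` the multiples of `4` carry `f`, position `2` carries `b`, and the odd
    -- positions carry `h`. In the given triple, `a` and `b` sit at positions `1` and `3`.
    (fun _ σ x => bif x % 2 == 0 then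
      (bif x % 4 == 0 then σ[x / 2]? else bif x == 2 then σ[3]? else some 0)
      else σ[1]?.bind fun a => approx a (evens σ) (x / 2)) (by fun_prop)
  refine ⟨s (), e, ?_⟩
  rintro _ ⟨f, a, b, h, rfl, hah, hh, hdom⟩
  have e1 : join f (join (ofNat a) (ofNat b)) 1 = a := by simp [join, ofNat]
  have e3 : join f (join (ofNat a) (ofNat b)) 3 = b := by simp [join, ofNat]
  refine ⟨join (join f (ofNat b)) h, ⟨f, b, h, rfl, hh, hdom⟩, hs _ _ _ ?_ ?_, ?_⟩
  · intro x t y hy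
    by_cases hx : x % 2 = 0
    · obtain ⟨x, rfl⟩ : ∃ k, x = 2 * k := ⟨x / 2, by omega⟩
      rw [join_two_mul]
      by_cases hx4 : 2 * x % 4 = 0
      · obtain ⟨x, rfl⟩ : ∃ k, x = 2 * k := ⟨x / 2, by omega⟩
        rw [join_two_mul]
        simp only [hx, beq_self_eq_true, cond_true, hx4, getElem?_initSeg_eq_some] at hy
        rw [← hy.2, show 2 * (2 * x) / 2 = 2 * x by omega, join_two_mul]
      · obtain ⟨x, rfl⟩ : ∃ k, x = 2 * k + 1 := ⟨x / 2, by omega⟩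
        rw [join_two_mul_add_one]
        rcases Nat.eq_zero_or_pos x with rfl | hx0
        · simp [getElem?_initSeg_eq_some, e3] at hy
          rw [← hy.2]
          simp [ofNat]
        · have : 2 * (2 * x + 1) ≠ 2 := by omega
          simp only [Bool.cond_eq_ite, beq_iff_eq, hx, hx4, this, if_true, if_false,
            Option.some.injEq] at hy
          simp [← hy, ofNat, hx0.ne']
    · obtain ⟨x, rfl⟩ : ∃ k, x = 2 * k + 1 := ⟨x / 2, by omega⟩
      rw [join_two_mul_add_one]
      simp only [beq_eq_false_iff_ne.2 hx, cond_false, Option.bind_eq_some_iff,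
        getElem?_initSeg_eq_some, e1, evens_initSeg_join] at hy
      obtain ⟨_, ⟨-, rfl⟩, hy⟩ := hy
      rw [show (2 * x + 1) / 2 = x by omega] at hy
      exact Part.mem_unique (mem_Phi_iff.2 ⟨_, hy⟩) (hah x)
  · intro x
    by_cases hx : x % 2 = 0
    · refine ⟨x + 4, ?_⟩
      rw [getElem?_initSeg _ (by omega), getElem?_initSeg _ (by omega)]
      simp only [hx, beq_self_eq_true, cond_true]
      cases x % 4 == 0 <;> cases x == 2 <;> simp
    · obtain ⟨t, ht⟩ := mem_Phi_iff.1 (hah (x / 2))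
      refine ⟨2 * t + 2, ?_⟩
      rw [getElem?_initSeg (n := 1) _ (by omega), e1, evens_initSeg_join]
      simp [beq_eq_false_iff_ne.2 hx, approx_initSeg_mono (show t ≤ t + 1 by omega) ht]
  · rintro p ⟨f', b', h', heq, g, hg, y, hy, rfl⟩
    simp only [join_inj, ofNat_inj] at heq
    obtain ⟨⟨rfl, rfl⟩, rfl⟩ := heq
    exact ⟨ofNat y, ⟨f, a, b, h, rfl, hah, g, hg, y, hy, rfl⟩, he _⟩

/-- The instance `k` of `P` produced by the reduction serves as the sequence in the triple, with the
identity as its first functional. The second functional ignores `k` and applies the backward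
reduction; its value at `0` determines the whole solution by `hQ`. -/
theorem StrongReducible.firstOrderPart {Q P : Problem} (h : StrongReducible Q P)
    (hQ : ∀ f ∈ Q.dom, ∀ r ∈ Q.sol f, ∃ y, r = ofNat y) : StrongReducible Q P.firstOrderPart := by
  obtain ⟨e, he⟩ := exists_id_index
  obtain ⟨a, b, h⟩ := h
  obtain ⟨c, -, hc⟩ := exists_index_computes (α := Unit) (fun _ σ x => approx b (odds σ) x)
    (by fun_prop)
  have hc : ∀ f p q, Computes b p q → Computes (c ()) (join f p) q := by
    intro f p q hq
    refine hc _ _ _ (fun x t y hy => ?_) fun x => ?_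
    · rw [odds_initSeg_join] at hy
      exact Part.mem_unique (mem_Phi_iff.2 ⟨_, hy⟩) (hq x)
    · obtain ⟨t, ht⟩ := mem_Phi_iff.1 (hq x)
      refine ⟨2 * t, ?_⟩
      rw [odds_initSeg_join, show 2 * t / 2 = t by omega, ht]
      simp
  obtain ⟨s, -, hs⟩ := exists_index_computes (α := Unit)
    (fun _ σ x => bif x % 2 == 0 then approx a σ (x / 2) else
      some (bif x == 1 then e else bif x == 3 then c () else 0)) (by fun_prop)
  refine ⟨s (), e, fun f hf => ?_⟩
  obtain ⟨k, hk, hak, h⟩ := h f hf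
  have hval : ∀ g ∈ P.sol k, ∃ y, y ∈ Phi (c ()) (join k g) 0 ∧ ofNat y ∈ Q.sol f := by
    intro g hg
    obtain ⟨q, hq, hbq⟩ := h g hg
    obtain ⟨y, rfl⟩ := hQ f hf q hq
    exact ⟨y, hc k g _ hbq 0, hq⟩
  refine ⟨join k (join (ofNat e) (ofNat (c ()))), ⟨k, e, c (), k, rfl, he k, hk, fun g hg => ?_⟩,
    hs _ _ _ ?_ ?_, ?_⟩
  · obtain ⟨y, hy, -⟩ := hval g hg
    exact Part.dom_iff_mem.2 ⟨y, hy⟩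
  · intro x t y hy
    by_cases hx : x % 2 = 0
    · obtain ⟨x, rfl⟩ : ∃ k, x = 2 * k := ⟨x / 2, by omega⟩
      rw [join_two_mul]
      simp only [hx, beq_self_eq_true, cond_true, Nat.mul_div_cancel_left x two_pos] at hy
      exact Part.mem_unique (mem_Phi_iff.2 ⟨_, hy⟩) (hak x)
    · obtain ⟨x, rfl⟩ : ∃ k, x = 2 * k + 1 := ⟨x / 2, by omega⟩
      rw [join_two_mul_add_one]
      simp only [beq_eq_false_iff_ne.2 hx, cond_false, Option.some.injEq] at hy
      subst hy
      match x with
      | 0 => simp [join, ofNat]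
      | 1 => simp [join, ofNat]
      | x + 2 =>
        have h1 : (x + 2) / 2 ≠ 0 := by omega
        have h2 : 2 * (x + 2) + 1 ≠ 1 := by omega
        have h3 : 2 * (x + 2) + 1 ≠ 3 := by omega
        rw [beq_eq_false_iff_ne.2 h2, beq_eq_false_iff_ne.2 h3]
        by_cases hx2 : (x + 2) % 2 = 0 <;> simp [join, ofNat]
  · intro x
    obtain ⟨t, ht⟩ := mem_Phi_iff.1 (hak (x / 2))
    refine ⟨t, ?_⟩
    rw [ht]
    cases x % 2 == 0 <;> simp
  · rintro p ⟨k', e', c', l, heq, hkl, g, hg, y, hy, rfl⟩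
    simp only [join_inj, ofNat_inj] at heq
    obtain ⟨rfl, rfl, rfl⟩ := heq
    obtain rfl := hkl.unique (he k)
    obtain ⟨z, hz, hzs⟩ := hval g hg
    rw [Part.mem_unique hy hz]
    exact ⟨_, hzs, he _⟩

/-! ### Observations of jumps -/

theorem turingJump_eq_one {f : Baire} {e : ℕ} : turingJump f e = 1 ↔ (Phi e f e).Dom := by
  simp [turingJump]

theorem turingJump_congr {f g : Baire} {e d : ℕ} (h : (Phi e f e).Dom ↔ (Phi d g d).Dom) :
    turingJump f e = turingJump g d := by
  by_cases hd : (Phi d g d).Dom <;> simp [turingJump, h, hd]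

/-- Uniformly in `f` and `g`, the jump of `⟨f, g⟩` computes `f` and the jump of `g`. -/
theorem exists_index_join_turingJump :
    ∃ e, ∀ f g, Computes e (turingJump (join f g)) (join f (turingJump g)) := by
  -- The functional with index `s (x, y)` halts on `⟨f, g⟩` exactly when `f x = y`, whatever its
  -- input.
  obtain ⟨s, hs, H⟩ := exists_index (α := ℕ × ℕ)
    (fun p σ _ => σ[2 * p.1]?.bind fun v => bif v == p.2 then some 0 else none) (by fun_prop)
  -- With index `r e`, the functional simulates `Φ_e` on `g` and `e`, so position `r e` of the jump
  -- of `⟨f, g⟩` is position `e` of the jump of `g`.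
  obtain ⟨r, hr, K⟩ := exists_index (α := ℕ) (fun e σ _ => approx e (odds σ) e) (by fun_prop)
  have H' : ∀ f g x y, turingJump (join f g) (s (x, y)) = 1 ↔ f x = y := by
    intro f g x y
    rw [turingJump_eq_one]
    constructor
    · intro h
      obtain ⟨z, hz⟩ := Part.dom_iff_mem.1 h
      obtain ⟨t, ht⟩ := (H (x, y) _ _).1 z hz
      obtain ⟨v, hv, ht⟩ := Option.bind_eq_some_iff.1 ht
      rw [getElem?_initSeg_eq_some, join_two_mul] at hv
      rw [hv.2]
      by_contra hc
      simp [Bool.cond_eq_ite, hc] at ht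
    · rintro rfl
      refine (H (x, f x) _ _).2 ⟨2 * x + 1, ?_⟩
      rw [getElem?_initSeg _ (by omega), join_two_mul]
      simp
  have K' : ∀ f g e, turingJump (join f g) (r e) = turingJump g e := by
    intro f g e
    refine turingJump_congr ⟨fun h => ?_, fun h => ?_⟩
    · obtain ⟨z, hz⟩ := Part.dom_iff_mem.1 h
      obtain ⟨t, ht⟩ := (K e _ _).1 z hz
      rw [odds_initSeg_join] at ht
      exact Phi_dom_iff.2 ⟨t / 2, by simp [ht]⟩
    · obtain ⟨t, ht⟩ := Phi_dom_iff.1 h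
      refine (K e _ _).2 ⟨2 * t, ?_⟩
      rwa [odds_initSeg_join, show 2 * t / 2 = t by omega]
  obtain ⟨e, -, he⟩ := exists_index_computes (α := Unit)
    (fun _ σ x => bif x % 2 == 0 then
      firstSome (fun y => bif σ.getD (s (x / 2, y)) 0 == 1 then some y else none) σ.length
      else σ[r (x / 2)]?) (by fun_prop)
  refine ⟨e (), fun f g => he _ _ _ (fun x t y hy => ?_) fun x => ?_⟩
  · obtain ⟨x, rfl | rfl⟩ : ∃ k, x = 2 * k ∨ x = 2 * k + 1 := ⟨x / 2, by omega⟩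
    · rw [join_two_mul]
      simp only [Nat.mul_mod_right, beq_self_eq_true, cond_true,
        Nat.mul_div_cancel_left x two_pos, firstSome_eq_some] at hy
      obtain ⟨z, -, hz, -⟩ := hy
      by_cases hc : s (x, z) < t
      · rw [getD_initSeg _ _ hc, Bool.cond_eq_ite] at hz
        split_ifs at hz with h1
        rw [beq_iff_eq, H'] at h1
        rw [h1, Option.some.inj hz]
      · simp [hc] at hz
    · have h1 : (2 * x + 1) % 2 ≠ 0 := by omega
      have h2 : (2 * x + 1) / 2 = x := by omega
      rw [join_two_mul_add_one]
      simp only [beq_eq_false_iff_ne.2 h1, cond_false, h2, getElem?_initSeg_eq_some] at hy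
      rw [← hy.2, K']
  · by_cases hx : x % 2 = 0
    · refine ⟨max (f (x / 2)) (s (x / 2, f (x / 2))) + 1, fun hcon => ?_⟩
      simp only [hx, beq_self_eq_true, cond_true, firstSome_eq_none, length_initSeg] at hcon
      have := hcon (f (x / 2)) (by omega)
      rw [getD_initSeg _ _ (by omega), (H' f g _ _).2 rfl] at this
      simp at this
    · refine ⟨r (x / 2) + 1, ?_⟩
      rw [getElem?_initSeg _ (by omega)]
      simp [beq_eq_false_iff_ne.2 hx]

/-- From `⟨⟨f, b⟩, ⟨f₁, i⟩⟩` pass to the oracle `⟨f, f₁⟩`. Its jump computes `f` and the jump of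
`f₁`, from which `Φ_i` computes the instance `g`; hence it computes `⟨⟨f, b⟩, g⟩`, by an index
computable from `b` and `i`. -/
theorem observation_jump_reducible (P : Problem) :
    StrongReducible P.jump.observation P.observation.jump := by
  obtain ⟨d, hd⟩ := exists_id_index
  obtain ⟨e, he⟩ := exists_index_join_turingJump
  obtain ⟨s, hs, hcomp⟩ := exists_comp_index
  obtain ⟨j, hj, hjc⟩ := exists_index_computes (α := ℕ × ℕ)
    (fun p σ x => bif x % 2 == 0 then
      (bif x % 4 == 0 then σ[x / 2]? else some (ofNat p.1 (x / 4)))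
      else approx p.2 (odds σ) (x / 2)) (by fun_prop)
  have hjc : ∀ b i f f₁ g, Computes i f₁ g →
      Computes (j (b, i)) (join f f₁) (join (join f (ofNat b)) g) := by
    intro b i f f₁ g hi
    refine hjc _ _ _ (fun x t y hy => ?_) fun x => ?_
    · obtain ⟨x, rfl | rfl⟩ : ∃ k, x = 2 * k ∨ x = 2 * k + 1 := ⟨x / 2, by omega⟩
      · rw [join_two_mul]
        have h1 : 2 * x % 2 = 0 := by omega
        have h2 : 2 * x / 2 = x := by omega
        simp only [h1, h2, beq_self_eq_true, cond_true] at hy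
        obtain ⟨x, rfl | rfl⟩ : ∃ k, x = 2 * k ∨ x = 2 * k + 1 := ⟨x / 2, by omega⟩
        · have h3 : 2 * (2 * x) % 4 = 0 := by omega
          simp only [h3, beq_self_eq_true, cond_true, getElem?_initSeg_eq_some,
            join_two_mul] at hy
          rw [join_two_mul, hy.2]
        · have h3 : 2 * (2 * x + 1) % 4 ≠ 0 := by omega
          have h4 : 2 * (2 * x + 1) / 4 = x := by omega
          simp only [beq_eq_false_iff_ne.2 h3, cond_false, h4, Option.some.injEq] at hy
          rw [join_two_mul_add_one, hy]
      · have h1 : (2 * x + 1) % 2 ≠ 0 := by omega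
        have h2 : (2 * x + 1) / 2 = x := by omega
        simp only [beq_eq_false_iff_ne.2 h1, cond_false, h2, odds_initSeg_join] at hy
        rw [join_two_mul_add_one]
        exact Part.mem_unique (mem_Phi_iff.2 ⟨_, hy⟩) (hi x)
    · by_cases hx : x % 2 = 0
      · refine ⟨x + 1, ?_⟩
        rw [getElem?_initSeg _ (by omega)]
        simp only [hx, beq_self_eq_true, cond_true]
        cases x % 4 == 0 <;> simp
      · obtain ⟨t, ht⟩ := mem_Phi_iff.1 (hi (x / 2))
        refine ⟨2 * t, ?_⟩
        rw [odds_initSeg_join, show 2 * t / 2 = t by omega, ht]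
        simp [beq_eq_false_iff_ne.2 hx]
  obtain ⟨c, hc⟩ := exists_index_of_bound
    -- In the given instance `f` occupies the multiples of `4`, `f₁` the positions congruent to `1`
    -- modulo `4`, and `b` and `i` sit at `2` and `3`. So `f` stays in place and `f₁` moves up by
    -- one position.
    (fun σ x => bif x % 2 == 0 then (bif x % 4 == 0 then σ.getD x 0 else σ.getD (x - 1) 0)
      else bif x == 1 then s (e, j (σ.getD 2 0, σ.getD 3 0)) else 0) (fun x => x + 2)
    (by fun_prop) (by fun_prop)
  refine ⟨c, d, ?_⟩
  rintro _ ⟨f, b, _, rfl, ⟨f₁, i, g, rfl, hi, hg⟩, hdom⟩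
  have hsol : P.jump.sol (join f₁ (ofNat i)) = P.sol g := by
    ext p
    constructor
    · rintro ⟨f₂, i', g', heq, hi', hp⟩
      simp only [join_inj, ofNat_inj] at heq
      obtain ⟨rfl, rfl⟩ := heq
      rwa [hi.unique hi']
    · exact fun hp => ⟨f₁, i, g, rfl, hi, hp⟩
  rw [hsol] at hdom
  have hk : IsDelta2Index (join f f₁) (s (e, j (b, i))) (join (join f (ofNat b)) g) :=
    hcomp _ _ _ _ _ (he f f₁) (hjc b i f _ g hi)
  refine ⟨join (join f f₁) (ofNat (s (e, j (b, i)))),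
    ⟨_, _, _, rfl, hk, f, b, g, rfl, hg, hdom⟩, hc _ _ fun x t hxt => ?_, ?_⟩
  · set q := join (join f (ofNat b)) (join f₁ (ofNat i)) with hq
    have h2 : q 2 = b := by simp [hq, join, ofNat]
    have h3 : q 3 = i := by simp [hq, join, ofNat]
    obtain ⟨x, rfl | rfl⟩ : ∃ k, x = 2 * k ∨ x = 2 * k + 1 := ⟨x / 2, by omega⟩
    · rw [getD_initSeg _ _ (by omega), getD_initSeg _ _ (by omega), join_two_mul]
      obtain ⟨x, rfl | rfl⟩ : ∃ k, x = 2 * k ∨ x = 2 * k + 1 := ⟨x / 2, by omega⟩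
      · have h4 : 2 * (2 * x) % 4 = 0 := by omega
        simp [h4, hq, join_two_mul]
      · have h4 : 2 * (2 * x + 1) % 4 ≠ 0 := by omega
        have h5 : 2 * (2 * x + 1) - 1 = 2 * (2 * x) + 1 := by omega
        simp only [Nat.mul_mod_right, beq_self_eq_true, cond_true, beq_eq_false_iff_ne.2 h4,
          cond_false, h5, hq, join_two_mul_add_one, join_two_mul]
    · rw [getD_initSeg (n := 2) _ _ (by omega), getD_initSeg (n := 3) _ _ (by omega), h2, h3,
        join_two_mul_add_one]
      by_cases hx : x = 0 <;> simp [hx, Bool.cond_eq_ite, ofNat]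
  · rintro p ⟨f', i', k', heq, hk', f₂, b', g', rfl, hp⟩
    simp only [join_inj, ofNat_inj] at heq
    obtain ⟨rfl, rfl⟩ := heq
    have := hk.unique hk'
    simp only [join_inj, ofNat_inj] at this
    obtain ⟨⟨rfl, rfl⟩, rfl⟩ := this
    refine ⟨p, ⟨f, b, _, rfl, ?_⟩, hd p⟩
    rwa [hsol]

theorem observation_iterJump_reducible {P Q : Problem} (h : StrongReducible P.observation Q)
    (n : ℕ) : StrongReducible (P.iterJump n).observation (Q.iterJump n) := by
  induction n with
  | zero => exact h
  | succ n ih => exact (observation_jump_reducible _).trans ih.jump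

/-! ### Tuples -/

@[simp] theorem tuple_zero (k : ℕ) (F : Fin k → Baire) : tuple k F 0 = k := rfl

theorem tuple_succ {k : ℕ} (F : Fin k → Baire) (i : Fin k) (x : ℕ) :
    tuple k F (Nat.pair i x + 1) = F i x := by
  simp [tuple]

theorem tuple_inj {k : ℕ} {F G : Fin k → Baire} : tuple k F = tuple k G ↔ F = G := by
  refine ⟨fun h => funext fun i => funext fun x => ?_, fun h => h ▸ rfl⟩
  rw [← tuple_succ F, h, tuple_succ]

theorem eq_of_tuple_eq {k l : ℕ} {F : Fin k → Baire} {G : Fin l → Baire}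
    (h : tuple k F = tuple l G) : k = l := congrFun h 0

/-! ### Sets of binary strings -/

theorem codeSet_encode_eq_one {T : Set (List Bool)} {ρ : List Bool} :
    codeSet T (Encodable.encode ρ) = 1 ↔ ρ ∈ T := by
  simp [codeSet]

theorem codeSet_injective {T U : Set (List Bool)} (h : codeSet T = codeSet U) : T = U := by
  ext ρ
  rw [← codeSet_encode_eq_one, h, codeSet_encode_eq_one]

theorem codeSet_eq {T : Set (List Bool)} {t : List Bool → Bool} {n : ℕ}
    (h : ∀ ρ, Encodable.encode ρ = n → (t ρ = true ↔ ρ ∈ T)) :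
    codeSet T n = ((Encodable.decode n : Option (List Bool)).map fun ρ =>
      (Encodable.encode ρ == n && t ρ).toNat).getD 0 := by
  by_cases hn : ∃ ρ : List Bool, Encodable.encode ρ = n
  · obtain ⟨ρ, rfl⟩ := hn
    have := h ρ rfl
    by_cases hρ : ρ ∈ T
    · simp [codeSet, hρ, this.2 hρ]
    · have ht : t ρ = false := by simpa [hρ] using this
      simp [codeSet, hρ, ht]
  · have h0 : codeSet T n = 0 := by
      simp only [codeSet]
      rw [if_neg]
      rintro ⟨ρ, -, rfl⟩
      exact hn ⟨ρ, rfl⟩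
    rw [h0]
    cases hd : (Encodable.decode n : Option (List Bool)) with
    | none => rfl
    | some ρ =>
      have : Encodable.encode ρ ≠ n := fun he => hn ⟨ρ, he⟩
      simp [beq_eq_false_iff_ne.2 this]

theorem infinite_of_mem_paths {T : Set (List Bool)} {x : ℕ → Bool} (h : x ∈ paths T) :
    T.Infinite := by
  refine Set.infinite_of_injective_forall_mem (f := initSeg x) (fun m n hmn => ?_) h
  simpa using congrArg List.length hmn

/-- The cylinder fixing `m` bits has as its measure a product of `m` nonzero factors. -/
theorem cantorMeasure_pos_of_cylinder_subset {S : Set (ℕ → Bool)} (y : ℕ → Bool) (m : ℕ)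
    (h : ∀ x : ℕ → Bool, (∀ j < m, x j = y j) → x ∈ S) : 0 < cantorMeasure S := by
  have hsub : Set.pi (Finset.range m : Set ℕ) (fun j => {y j}) ⊆ S := by
    intro x hx
    refine h x fun j hj => ?_
    simpa using hx j (by simpa using hj)
  refine lt_of_lt_of_le ?_ (MeasureTheory.measure_mono hsub)
  rw [cantorMeasure, MeasureTheory.Measure.infinitePi_pi _ (fun _ _ => .singleton _),
    pos_iff_ne_zero, Finset.prod_ne_zero_iff]
  intro j _
  rw [PMF.toMeasure_apply_singleton _ _ (.singleton _)]
  simp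

/-! ### Finite parallelizations of `C_2` reduce to `WWKL` -/

/-- The problem `C_2^*`, with each solution given by the code of a finite list of numbers. -/
def codedChoice : Problem where
  dom := (choice 2).finitePar.dom
  sol q := {r | ∃ (k : ℕ) (F : Fin k → Baire) (l : List ℕ), q = tuple k F ∧ l.length = k ∧
    (∀ i : Fin k, ofNat (l.getD i 0) ∈ (choice 2).sol (F i)) ∧ r = ofNat (Encodable.encode l)}

theorem finitePar_choice_reducible_codedChoice :
    StrongReducible (choice 2).finitePar codedChoice := by
  obtain ⟨e, he⟩ := exists_id_index
  obtain ⟨c, hc⟩ := exists_index_of_bound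
    (fun σ n => (fun l : List ℕ => Nat.rec (motive := fun _ => ℕ) l.length
      (fun m _ => bif decide (m.unpair.1 < l.length) then ofNat (l.getD m.unpair.1 0) m.unpair.2
        else 0) n) ((Encodable.decode (σ.getD 0 0) : Option (List ℕ)).getD []))
    (fun _ => 0) (by fun_prop) (by fun_prop)
  refine ⟨e, c, fun f hf => ⟨f, hf, he f, ?_⟩⟩
  rintro _ ⟨k, F, l, hq, rfl, hl, rfl⟩
  refine ⟨tuple l.length fun i => ofNat (l.getD i 0), ⟨_, F, _, hq, rfl, hl⟩,
    hc _ _ fun n t ht => ?_⟩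
  rw [getD_initSeg _ _ ht]
  cases n with
  | zero => simp [ofNat]
  | succ m =>
    by_cases hm : m.unpair.1 < l.length
    · simp [ofNat, tuple, hm]
    · simp [ofNat, tuple, hm]

/-- The tree of the strings `1 … 1 0 b_0 … b_{k - 1} ρ`, with `k` leading ones, such that `b_i` is
not among the numbers which are listed early by the `i`-th component of the `k`-tuple `q`. -/
def choiceTree (q : Baire) : Set (List Bool) :=
  {ρ | ∀ j < ρ.length, (j < q 0 → ρ.getD j false = true) ∧ (j = q 0 → ρ.getD j false = false) ∧
    (q 0 < j → j < 2 * q 0 + 1 → ∀ s < ρ.length,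
      q (Nat.pair (j - q 0 - 1) s + 1) ≠ (ρ.getD j false).toNat)}

theorem isTree_choiceTree (q : Baire) : IsTree (choiceTree q) := by
  rintro _ hρ τ ⟨ρ, rfl⟩ j hj
  have := hρ j (by simp; omega)
  rw [List.getD_append _ _ _ _ hj] at this
  exact ⟨this.1, this.2.1, fun h1 h2 s hs => this.2.2 h1 h2 s (by simp; omega)⟩

/-- The positions inspected are `0` and `⟨i, s⟩ + 1` with `i, s < |ρ|`, and pairing is bounded by a
square. This gives the use bound that makes the tree computable. -/
theorem choiceTree_congr {q r : Baire} {ρ : List Bool}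
    (h : ∀ n ≤ ρ.length * ρ.length, q n = r n) : ρ ∈ choiceTree q ↔ ρ ∈ choiceTree r := by
  have h0 := h 0 (Nat.zero_le _)
  simp only [choiceTree, Set.mem_ofPred_eq, h0]
  refine forall₂_congr fun j hj => and_congr_right fun _ => and_congr_right fun _ =>
    forall₂_congr fun h1 h2 => forall₂_congr fun s hs => ?_
  rw [h]
  have h3 := Nat.pair_lt_max_add_one_sq (j - r 0 - 1) s
  have h4 : max (j - r 0 - 1) s + 1 ≤ ρ.length := by omega
  have h5 := h3.trans_le (Nat.pow_le_pow_left h4 2)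
  rwa [sq] at h5

theorem exists_index_choiceTree : ∃ e, ∀ q, Computes e q (codeSet (choiceTree q)) := by
  obtain ⟨e, he⟩ := exists_index_of_bound
    (fun σ n => ((Encodable.decode n : Option (List Bool)).map fun ρ =>
      (Encodable.encode ρ == n && (List.range ρ.length).all fun j =>
        (!decide (j < σ.getD 0 0) || ρ.getD j false) &&
        ((!(j == σ.getD 0 0) || !ρ.getD j false) &&
        (!decide (σ.getD 0 0 < j) || (!decide (j < 2 * σ.getD 0 0 + 1) ||
        (List.range ρ.length).all fun s =>
          !(σ.getD (Nat.pair (j - σ.getD 0 0 - 1) s + 1) 0 == (ρ.getD j false).toNat))))).toNat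
      ).getD 0)
    (fun n => n * n) (by fun_prop) (by fun_prop)
  refine ⟨e, fun q => he _ _ fun n t ht => (codeSet_eq fun ρ hρ => ?_).symm⟩
  have hlen : ρ.length ≤ n := hρ ▸ Encodable.length_le_encode ρ
  have hlen2 := Nat.mul_le_mul hlen hlen
  rw [choiceTree_congr (r := fun n => (initSeg q t).getD n 0)
    fun n hn => (getD_initSeg _ _ (by omega)).symm]
  simp only [choiceTree, Set.mem_ofPred_eq, List.all_eq_true, List.mem_range, Bool.and_eq_true,
    Bool.or_eq_true, Bool.not_eq_true', decide_eq_false_iff_not, beq_eq_false_iff_ne, ne_eq,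
    imp_iff_not_or]

/-- The unary block lets `k` be read off a path; the bits from position `2k + 1` on are
unconstrained. -/
theorem mem_paths_choiceTree {k : ℕ} {F : Fin k → Baire} {x : ℕ → Bool} :
    x ∈ paths (choiceTree (tuple k F)) ↔ (∀ j < k, x j = true) ∧ x k = false ∧
      ∀ (i : Fin k) (s : ℕ), F i s ≠ (x (k + 1 + i)).toNat := by
  constructor
  · intro hx
    have hx' : ∀ j n, j < n → _ := fun j n hj => hx n j (by simpa using hj)
    refine ⟨fun j hj => ?_, ?_, fun i s => ?_⟩
    · have := (hx' j (j + 1) (by omega)).1 hj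
      rwa [getD_initSeg _ _ (by omega)] at this
    · have := (hx' k (k + 1) (by omega)).2.1 rfl
      rwa [getD_initSeg _ _ (by omega)] at this
    · have hi := i.2
      have := (hx' (k + 1 + i) (k + 1 + i + s + 1) (by omega)).2.2
        (show k < _ by omega) (show _ < 2 * k + 1 by omega) s (by simp)
      rwa [getD_initSeg _ _ (by omega), tuple_zero, show k + 1 + i - k - 1 = i by omega,
        tuple_succ] at this
  · rintro ⟨h1, h2, h3⟩ n j hj
    rw [length_initSeg] at hj
    rw [getD_initSeg _ _ hj, tuple_zero]
    refine ⟨h1 j, fun h => h ▸ h2, fun h4 h5 s _ => ?_⟩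
    have := h3 ⟨j - k - 1, by omega⟩ s
    rw [← tuple_succ F] at this
    simpa [show k + 1 + (j - k - 1) = j by omega] using this

theorem codedChoice_reducible_WWKL : StrongReducible codedChoice WWKL := by
  obtain ⟨e, he⟩ := exists_index_choiceTree
  obtain ⟨c, -, hc⟩ := exists_index_computes (α := Unit)
    (fun _ σ n => bif n == 0 then
      -- If no zero has been seen, `findIdx` returns the length of `σ` and the test fails. If it
      -- succeeds, the first zero and the `k` bits after it have been seen.
      (fun k => bif decide (2 * k < σ.length) then
        some (Encodable.encode ((List.range k).map fun i => σ.getD (k + 1 + i) 0)) else none)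
        (σ.findIdx fun v => v == 0)
      else some 0) (by fun_prop)
  refine ⟨e, c (), ?_⟩
  rintro _ ⟨k, F, hk, hF, rfl⟩
  have hy : ∃ y : ℕ → Bool, ∀ x : ℕ → Bool, (∀ j < 2 * k + 1, x j = y j) →
      x ∈ paths (choiceTree (tuple k F)) := by
    have : ∀ i : Fin k, ∃ b : Bool, ∀ s, F i s ≠ b.toNat := by
      intro i
      obtain ⟨-, ⟨b, hb, h⟩, -⟩ := hF i
      interval_cases b
      exacts [⟨false, h⟩, ⟨true, h⟩]
    choose b hb using this
    refine ⟨fun j => if j < k then true else if h : j - k - 1 < k ∧ j ≠ k then b ⟨j - k - 1, h.1⟩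
      else false, fun x hx => mem_paths_choiceTree.2 ⟨fun j hj => ?_, ?_, fun i s => ?_⟩⟩
    · rw [hx j (by omega)]
      exact if_pos hj
    · rw [hx k (by omega)]
      simp
    · have hi := i.2
      have h1 : ¬(k + 1 + i < k) := by omega
      have h2 : k + 1 + (i : ℕ) - k - 1 = i := by omega
      have h3 : k + 1 + (i : ℕ) ≠ k := by omega
      rw [hx _ (by omega)]
      simpa [h1, h2, h3] using hb i s
  obtain ⟨y, hy⟩ := hy
  refine ⟨_, ⟨_, isTree_choiceTree _, infinite_of_mem_paths (hy y fun _ _ => rfl),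
    cantorMeasure_pos_of_cylinder_subset y _ hy, rfl⟩, he _, ?_⟩
  rintro _ ⟨T, hT, x, hx, rfl⟩
  obtain rfl := codeSet_injective hT
  obtain ⟨h1, h2, h3⟩ := mem_paths_choiceTree.1 hx
  set p : Baire := fun n => (x n).toNat with hp
  have hfind : ∀ t, 2 * ((initSeg p t).findIdx fun v => v == 0) < t ∨ 2 * k < t →
      ((initSeg p t).findIdx fun v => v == 0) = k := by
    intro t ht
    by_cases hkt : k < t
    · rw [List.findIdx_eq (by simpa using hkt)]
      refine ⟨by simp [initSeg, hp, h2], fun j hj => by simp [initSeg, hp, h1 j hj]⟩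
    · have hnone : ((initSeg p t).findIdx fun v => v == 0) = t := by
        refine (List.findIdx_eq_length.2 ?_).trans (length_initSeg p t)
        intro v hv
        simp only [initSeg, List.mem_map, List.mem_range] at hv
        obtain ⟨j, hj, rfl⟩ := hv
        simp [hp, h1 j (by omega)]
      omega
  refine ⟨_, ⟨k, F, (List.range k).map fun i => p (k + 1 + i), rfl, by simp, fun i => ?_, rfl⟩,
    hc _ _ _ (fun n t v hv => ?_) fun n => ?_⟩
  · refine ⟨p (k + 1 + i), by simp only [hp]; cases x (k + 1 + i) <;> simp, h3 i, ?_⟩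
    rw [← initSeg, getD_initSeg _ _ i.2]
  · by_cases hn : n = 0
    · subst hn
      simp only [beq_self_eq_true, cond_true, length_initSeg] at hv
      simp only [Bool.cond_eq_ite, decide_eq_true_eq] at hv
      split_ifs at hv with hlt
      rw [hfind t (Or.inl hlt)] at hv hlt
      rw [← Option.some.inj hv]
      simp only [ofNat, if_true]
      congr 1
      refine List.map_congr_left fun i hi => ?_
      rw [List.mem_range] at hi
      rw [getD_initSeg _ _ (by omega)]
    · simp only [beq_eq_false_iff_ne.2 hn, cond_false, Option.some.injEq] at hv
      rw [← hv, ofNat, if_neg hn]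
  · refine ⟨2 * k + 1, ?_⟩
    rw [hfind _ (Or.inr (by omega))]
    by_cases hn : n = 0 <;> simp [hn, Bool.cond_eq_ite]

/-! ### The reductions involving `WWKL`, for iterated jumps -/

theorem codedChoice_sol {f r : Baire} (hr : r ∈ codedChoice.sol f) : ∃ y, r = ofNat y := by
  obtain ⟨k, F, l, -, -, -, rfl⟩ := hr
  exact ⟨_, rfl⟩

theorem exists_eq_ofNat_of_mem_iterJump_sol {P : Problem}
    (h : ∀ f, ∀ r ∈ P.sol f, ∃ y, r = ofNat y) (n : ℕ) :
    ∀ f, ∀ r ∈ (P.iterJump n).sol f, ∃ y, r = ofNat y := by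
  induction n with
  | zero => exact h
  | succ n ih =>
    rintro _ r ⟨-, -, g, -, -, hr⟩
    exact ih g r hr

theorem iterJump_finitePar_choice_reducible (n : ℕ) :
    StrongReducible ((choice 2).finitePar.iterJump n) (WWKL.iterJump n).firstOrderPart :=
  (finitePar_choice_reducible_codedChoice.iterJump n).trans <|
    (codedChoice_reducible_WWKL.iterJump n).firstOrderPart fun f _ r hr =>
      exists_eq_ofNat_of_mem_iterJump_sol (fun _ _ => codedChoice_sol) n f r hr

theorem firstOrderPart_WWKL_reducible (n : ℕ) :
    StrongReducible (WWKL.iterJump n).firstOrderPart (WKL.iterJump n).firstOrderPart := by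
  have h : (WWKL.iterJump n).dom ⊆ (WKL.iterJump n).dom ∧
      (WWKL.iterJump n).sol = (WKL.iterJump n).sol := by
    induction n with
    | zero => exact ⟨by rintro _ ⟨T, h1, h2, -, h3⟩; exact ⟨T, h1, h2, h3⟩, rfl⟩
    | succ n ih =>
      constructor
      · rintro _ ⟨f, i, g, rfl, hi, hg⟩
        exact ⟨f, i, g, rfl, hi, ih.1 hg⟩
      · funext q
        simp only [Problem.iterJump, Problem.jump, ih.2]
  refine .of_subset ?_ fun f _ => ?_
  · rintro _ ⟨f, a, b, k, rfl, ha, hk, hdom⟩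
    exact ⟨f, a, b, k, rfl, ha, h.1 hk, h.2 ▸ hdom⟩
  · rw [Problem.firstOrderPart, Problem.firstOrderPart, h.2]

/-! ### Paths through binary trees -/

/-- The set `T` contains extensions of the string `τ` of every length. -/
def Extendible (T : Set (List Bool)) (τ : List Bool) : Prop :=
  ∀ s, ∃ ρ : List Bool, ρ.length = s ∧ τ ++ ρ ∈ T

/-- The string of length `n` whose bits are given by `c` from the preceding ones. -/
def walk (c : List Bool → Bool) (n : ℕ) : List Bool :=
  Nat.rec (motive := fun _ => List Bool) [] (fun _ τ => τ ++ [c τ]) n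

@[fun_prop] theorem primrec_walk {α : Type*} [Primcodable α] {c : α → List Bool → Bool}
    {n : α → ℕ} (hc : Primrec (fun p : α × List Bool => c p.1 p.2)) (hn : Primrec n) :
    Primrec (fun a => walk (c a) (n a)) := by
  unfold walk
  have : Primrec (fun p : α × ℕ × List Bool => c p.1 p.2.2) :=
    hc.comp (Primrec.fst.pair (Primrec.snd.comp Primrec.snd))
  fun_prop

theorem walk_succ (c : List Bool → Bool) (n : ℕ) : walk c (n + 1) = walk c n ++ [c (walk c n)] :=
  rfl

@[simp] theorem length_walk (c : List Bool → Bool) (n : ℕ) : (walk c n).length = n := by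
  induction n with
  | zero => rfl
  | succ n ih => simp [walk_succ, ih]

theorem walk_congr {c d : List Bool → Bool} {n : ℕ} (h : ∀ j < n, c (walk c j) = d (walk c j)) :
    walk c n = walk d n := by
  induction n with
  | zero => rfl
  | succ n ih =>
    rw [walk_succ, walk_succ, ← ih fun j hj => h j (by omega), h n (by omega)]

theorem initSeg_walk (c : List Bool → Bool) (n : ℕ) :
    initSeg (fun m => c (walk c m)) n = walk c n := by
  induction n with
  | zero => rfl
  | succ n ih => rw [initSeg_succ, ih, walk_succ]

theorem Extendible.mem {T : Set (List Bool)} {τ : List Bool} (h : Extendible T τ) : τ ∈ T := by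
  obtain ⟨ρ, hρ, h⟩ := h 0
  rw [List.length_eq_zero_iff] at hρ
  simpa [hρ] using h

/-- Truncation shows that once no extension by `s₀` bits is in the tree, no longer one is. -/
theorem not_extendible_iff {T : Set (List Bool)} (hT : IsTree T) {τ : List Bool} :
    ¬Extendible T τ ↔ ∃ s₀, ∀ s ≥ s₀, ∀ ρ : List Bool, ρ.length = s → τ ++ ρ ∉ T := by
  constructor
  · intro h
    simp only [Extendible, not_forall, not_exists, not_and] at h
    obtain ⟨s₀, h⟩ := h
    refine ⟨s₀, fun s hs ρ hρ hmem => h (ρ.take s₀) (by simp; omega) (hT _ hmem _ ?_)⟩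
    exact (List.prefix_append_right_inj τ).2 (List.take_prefix _ _)
  · rintro ⟨s₀, h⟩ hext
    obtain ⟨ρ, hρ, hmem⟩ := hext s₀
    exact h s₀ le_rfl ρ hρ hmem

theorem Extendible.append {T : Set (List Bool)} (hT : IsTree T) {τ : List Bool}
    (h : Extendible T τ) (b : Bool) :
    Extendible T (τ ++ [b]) ∨ Extendible T (τ ++ [!b]) := by
  by_contra hcon
  rw [not_or, not_extendible_iff hT, not_extendible_iff hT] at hcon
  obtain ⟨⟨s, hs⟩, t, ht⟩ := hcon
  obtain ⟨ρ, hρ, hmem⟩ := h (max s t + 1)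
  obtain ⟨d, ρ, rfl⟩ := List.exists_cons_of_length_eq_add_one hρ
  rw [List.length_cons, Nat.add_right_cancel_iff] at hρ
  rw [List.append_cons] at hmem
  by_cases hd : d = b
  · exact hs _ (le_max_left _ _) ρ hρ (hd ▸ hmem)
  · obtain rfl : d = !b := by cases d <;> cases b <;> simp_all
    exact ht _ (le_max_right _ _) ρ hρ hmem

theorem extendible_nil {T : Set (List Bool)} (hT : IsTree T) (hinf : T.Infinite) :
    Extendible T [] := by
  by_contra hcon
  obtain ⟨s, hs⟩ := (not_extendible_iff hT).1 hcon
  refine hinf ((List.finite_length_lt Bool s).subset fun ρ hρ => ?_)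
  by_contra hlen
  exact hs ρ.length (not_lt.1 hlen) ρ rfl hρ

/-- A form of weak König's lemma with a prescribed beginning: the first `m` bits follow `c`, the
later ones are any that preserve extendibility. For `m = 0` it is the plain lemma. -/
theorem exists_mem_paths {T : Set (List Bool)} (hT : IsTree T) (h0 : Extendible T [])
    (c : List Bool → Bool) (m : ℕ)
    (h : ∀ j < m, Extendible T (walk c j) → Extendible T (walk c (j + 1))) :
    ∃ x ∈ paths T, initSeg x m = walk c m := by
  have hnext : ∀ τ, ∃ b, Extendible T τ → Extendible T (τ ++ [b]) := by
    intro τ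
    by_cases hτ : Extendible T τ
    · exact (hτ.append hT true).elim (fun h => ⟨_, fun _ => h⟩) fun h => ⟨_, fun _ => h⟩
    · exact ⟨true, fun h => absurd h hτ⟩
  choose d hd using hnext
  set c' : List Bool → Bool := fun τ => if τ.length < m then c τ else d τ with hc'
  have hcongr : ∀ n ≤ m, walk c' n = walk c n := fun n hn =>
    walk_congr fun j hj => if_pos (by simp; omega)
  have hext : ∀ n, Extendible T (walk c' n) := by
    intro n
    induction n with
    | zero => exact h0
    | succ n ih =>
      by_cases hn : n < m
      · rw [hcongr _ hn.le] at ih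
        rw [hcongr _ hn]
        exact h n hn ih
      · rw [walk_succ, hc']
        simp only [length_walk, hn, if_false]
        exact hd _ ih
  refine ⟨fun n => c' (walk c' n), fun n => ?_, ?_⟩
  · rw [initSeg_walk]
    exact (hext n).mem
  · rw [initSeg_walk, hcongr m le_rfl]

/-! ### Codes of binary strings -/

/-- A bound for the codes of the binary strings of length at most `m`. -/
def codeBound (m : ℕ) : ℕ :=
  Nat.rec (motive := fun _ => ℕ) 0 (fun _ r => Nat.succ (Nat.pair 1 r)) m

@[fun_prop] theorem primrec_codeBound {α : Type*} [Primcodable α] {m : α → ℕ} (hm : Primrec m) :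
    Primrec (fun a => codeBound (m a)) := by
  unfold codeBound
  fun_prop

theorem codeBound_mono : Monotone codeBound :=
  monotone_nat_of_le_succ fun n =>
    (Nat.right_le_pair 1 (codeBound n)).trans (Nat.le_succ _)

theorem natPair_le_natPair {a b c d : ℕ} (h : a ≤ b) (h' : c ≤ d) :
    Nat.pair a c ≤ Nat.pair b d :=
  (h.lt_or_eq.elim (fun h => (Nat.pair_lt_pair_left c h).le) fun h => h ▸ le_rfl).trans
  (h'.lt_or_eq.elim (fun h => (Nat.pair_lt_pair_right b h).le) fun h => h ▸ le_rfl)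

theorem encode_le_codeBound {τ : List Bool} {m : ℕ} (h : τ.length ≤ m) :
    Encodable.encode τ ≤ codeBound m := by
  refine le_trans ?_ (codeBound_mono h)
  clear h
  induction τ with
  | nil => exact le_rfl
  | cons b τ ih =>
    rw [Encodable.encode_list_cons]
    exact Nat.succ_le_succ (natPair_le_natPair (by cases b <;> simp) ih)

/-- The binary strings of length `m`. -/
def strings (m : ℕ) : List (List Bool) :=
  Nat.rec (motive := fun _ => List (List Bool)) [[]]
    (fun _ r => r.flatMap fun τ => [false :: τ, true :: τ]) m

@[fun_prop] theorem primrec_strings {α : Type*} [Primcodable α] {m : α → ℕ} (hm : Primrec m) :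
    Primrec (fun a => strings (m a)) := by
  unfold strings
  fun_prop

theorem mem_strings {m : ℕ} {τ : List Bool} : τ ∈ strings m ↔ τ.length = m := by
  induction m generalizing τ with
  | zero => simp [strings]
  | succ m ih =>
    change τ ∈ (strings m).flatMap (fun τ => [false :: τ, true :: τ]) ↔ _
    simp only [List.mem_flatMap, List.mem_cons, List.not_mem_nil, or_false, ih]
    constructor
    · rintro ⟨ρ, hρ, rfl | rfl⟩ <;> simp [hρ]
    · intro h
      obtain ⟨b, ρ, rfl⟩ := List.exists_cons_of_length_eq_add_one h
      refine ⟨ρ, by simpa using h, ?_⟩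
      cases b <;> simp

/-! ### Choices between the two extensions of a string -/

theorem firstSome_mono {α : Type} {S : ℕ → Option α} {s t : ℕ} {a : α} (h : s ≤ t)
    (hs : firstSome S s = some a) : firstSome S t = some a := by
  rw [firstSome_eq_some] at *
  obtain ⟨k, hk, h⟩ := hs
  exact ⟨k, by omega, h⟩

/-- The sequence is `2` until a value of `S` appears and then keeps that value forever, so at most
one of `0` and `1` is ever enumerated. -/
theorem firstSome_getD_mem_choice_dom {S : ℕ → Option ℕ} (hS : ∀ s a, S s = some a → a < 2) :
    (fun s => (firstSome S s).getD 2) ∈ (choice 2).dom := by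
  have hlt : ∀ s a, firstSome S s = some a → a < 2 := fun s a h => by
    obtain ⟨k, -, hk, -⟩ := firstSome_eq_some.1 h
    exact hS k a hk
  have hval : ∀ s, firstSome S s = none ∨ ∃ a < 2, firstSome S s = some a := fun s => by
    cases h : firstSome S s with
    | none => exact Or.inl rfl
    | some a => exact Or.inr ⟨a, hlt s a h, rfl⟩
  have htwo : ∀ s t, s < t → (firstSome S t).getD 2 = 2 → firstSome S s = none := by
    intro s t hst h
    rcases hval s with h0 | ⟨a, ha, h1⟩
    · exact h0
    · rw [firstSome_mono hst.le h1] at h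
      exact absurd h ha.ne
  refine ⟨fun s => ?_, ?_, fun s t hst hne h => ?_, fun s t hst heq u hsu hut => ?_⟩
  · rcases hval s with h | ⟨a, ha, h⟩
    · simp [h]
    · simpa [h] using ha.le
  · by_cases hex : ∃ s a, firstSome S s = some a
    · obtain ⟨s, a, h⟩ := hex
      have ha := hlt s a h
      refine ⟨1 - a, by omega, fun t ht => ?_⟩
      rcases hval t with h' | ⟨a', ha', h'⟩
      · simp only [h', Option.getD_none] at ht
        omega
      · have e1 := firstSome_mono (le_max_left s t) h
        have e2 := firstSome_mono (le_max_right s t) h'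
        rw [e1, Option.some.injEq] at e2
        simp only [h', Option.getD_some] at ht
        omega
    · refine ⟨0, by omega, fun t ht => ?_⟩
      rcases hval t with h' | ⟨a', ha', h'⟩
      · simp [h'] at ht
      · exact hex ⟨t, a', h'⟩
  · simp only at h hne
    rw [htwo s t hst h, h] at hne
    exact hne rfl
  · simp only at heq ⊢
    rcases hval s with h | ⟨a, ha, h⟩
    · rw [h] at heq
      rw [h, htwo u t hut heq.symm]
    · rw [h, firstSome_mono hsu.le h]

/-- The set of binary strings given by `o` does not contain an extension of `τ` by `s` bits. -/
def dead (o : Baire) (τ : List Bool) (s : ℕ) : Bool :=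
  (strings s).all fun ρ => !(o (Encodable.encode (τ ++ ρ)) == 1)

@[fun_prop] theorem primrec_dead {α : Type*} [Primcodable α] {o : α → Baire} {τ : α → List Bool}
    {s : α → ℕ} (ho : Primrec (fun p : α × ℕ => o p.1 p.2)) (hτ : Primrec τ) (hs : Primrec s) :
    Primrec (fun a => dead (o a) (τ a) (s a)) := by
  unfold dead
  have : Primrec (fun p : α × List Bool => o p.1 (Encodable.encode (τ p.1 ++ p.2))) :=
    ho.comp (Primrec.fst.pair (by fun_prop))
  fun_prop

theorem dead_iff {T : Set (List Bool)} {τ : List Bool} {s : ℕ} :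
    dead (codeSet T) τ s = true ↔ ∀ ρ : List Bool, ρ.length = s → τ ++ ρ ∉ T := by
  simp only [dead, List.all_eq_true, mem_strings, Bool.not_eq_true', beq_eq_false_iff_ne, ne_eq,
    codeSet_encode_eq_one]

theorem exists_dead_iff {T : Set (List Bool)} {τ : List Bool} :
    (∃ s, dead (codeSet T) τ s = true) ↔ ¬Extendible T τ := by
  simp only [dead_iff, Extendible, not_forall, not_exists, not_and]

/-- The first of the two one-bit extensions of `τ` which is found to be not extendible within the
set of binary strings given by `o`. -/
def deadBit (o : Baire) (τ : List Bool) (s : ℕ) : Option ℕ :=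
  bif dead o (τ ++ [false]) s then some 0 else bif dead o (τ ++ [true]) s then some 1 else none

theorem deadBit_lt_two {o : Baire} {τ : List Bool} {s a : ℕ} (h : deadBit o τ s = some a) :
    a < 2 := by
  simp only [deadBit, Bool.cond_eq_ite] at h
  split_ifs at h <;> rw [← Option.some.inj h] <;> decide

/-- The instance of `C_2` asking for an extendible one-bit extension of the string `τ`. -/
def branch (o : Baire) (τ : List Bool) : Baire := fun s => (firstSome (deadBit o τ) s).getD 2

@[fun_prop] theorem primrec_branch {α : Type*} [Primcodable α] {o : α → Baire}
    {τ : α → List Bool} {s : α → ℕ} (ho : Primrec (fun p : α × ℕ => o p.1 p.2)) (hτ : Primrec τ)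
    (hs : Primrec s) : Primrec (fun a => branch (o a) (τ a) (s a)) := by
  unfold branch deadBit
  have ho' : Primrec (fun p : (α × ℕ) × ℕ => o p.1.1 p.2) :=
    ho.comp ((Primrec.fst.comp Primrec.fst).pair Primrec.snd)
  fun_prop

/-- No hypothesis on `τ` is needed: if both extensions die out, only the first one discovered is
enumerated. So one may ask about all strings without knowing which are extendible. -/
theorem branch_mem_dom (o : Baire) (τ : List Bool) : branch o τ ∈ (choice 2).dom :=
  firstSome_getD_mem_choice_dom fun _ _ => deadBit_lt_two

theorem branch_congr {o o' : Baire} {τ : List Bool} {s : ℕ}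
    (h : ∀ n ≤ codeBound (τ.length + s + 1), o n = o' n) : branch o τ s = branch o' τ s := by
  have hdead : ∀ b, ∀ j < s, dead o (τ ++ [b]) j = dead o' (τ ++ [b]) j := by
    intro b j hj
    rw [Bool.eq_iff_iff]
    simp only [dead, List.all_eq_true, mem_strings]
    refine forall₂_congr fun ρ hρ => ?_
    rw [h _ (encode_le_codeBound (by simp; omega))]
  unfold branch
  rw [firstSome_congr fun j hj => ?_]
  rw [deadBit, deadBit, hdead _ j hj, hdead _ j hj]

/-- If the chosen extension were not extendible, the other one would be, and would never be found
dead. The chosen bit would then be the one enumerated, so it could not be a solution. -/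
theorem Extendible.append_of_mem_choice_sol {T : Set (List Bool)} (hT : IsTree T)
    {τ : List Bool} (h : Extendible T τ) {r : Baire}
    (hr : r ∈ (choice 2).sol (branch (codeSet T) τ)) : Extendible T (τ ++ [r 0 == 1]) := by
  obtain ⟨i, hi, hne, rfl⟩ := hr
  by_contra hcon
  have hi' : ofNat i 0 = i := rfl
  rw [hi'] at hcon
  obtain ⟨s, hs⟩ := exists_dead_iff.2 hcon
  have hother : Extendible T (τ ++ [!(i == 1)]) := (h.append hT _).resolve_left hcon
  have hsome : deadBit (codeSet T) τ s ≠ none := by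
    interval_cases i <;> simp only [deadBit, Bool.cond_eq_ite] at hs ⊢ <;> split_ifs <;> simp_all
  cases hf : firstSome (deadBit (codeSet T) τ) (s + 1) with
  | none => exact hsome (firstSome_eq_none.1 hf s (by omega))
  | some a =>
    have hne := hne (s + 1)
    simp only [branch, hf, Option.getD_some] at hne
    obtain ⟨k, -, hk, -⟩ := firstSome_eq_some.1 hf
    refine exists_dead_iff.1 ⟨k, ?_⟩ hother
    simp only [deadBit, Bool.cond_eq_ite] at hk
    split_ifs at hk with h0 h1 <;> obtain rfl := Option.some.inj hk <;> interval_cases i <;>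
      simp_all

/-! ### Observations of `WKL` reduce to finite parallelizations of `C_2` -/

/-- The initial segment of `⟨f, x⟩` given by an initial segment `l` of `f` and an initial
segment `τ` of `x`. -/
def interleave (l : List ℕ) (τ : List Bool) : List ℕ :=
  (List.range (2 * l.length)).map fun n =>
    bif n % 2 == 0 then l.getD (n / 2) 0 else (τ.getD (n / 2) false).toNat

@[fun_prop] theorem primrec_interleave {α : Type*} [Primcodable α] {l : α → List ℕ}
    {τ : α → List Bool} (hl : Primrec l) (hτ : Primrec τ) :
    Primrec (fun a => interleave (l a) (τ a)) := by
  unfold interleave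
  fun_prop

theorem interleave_initSeg (f : Baire) (x : ℕ → Bool) (m : ℕ) :
    interleave (initSeg f m) (initSeg x m) = initSeg (join f fun n => (x n).toNat) (2 * m) := by
  rw [interleave, length_initSeg]
  refine List.map_congr_left fun n hn => ?_
  rw [List.mem_range] at hn
  rw [getD_initSeg _ _ (by omega), getD_initSeg _ _ (by omega), join, Bool.cond_eq_ite]
  simp only [beq_iff_eq]

/-- The value `Φ_b(f, x)(0)` is computed from initial segments of length `m`, for all sequences `x`
with an initial segment of this length in `T`. -/
def Decided (f : Baire) (b : ℕ) (T : Set (List Bool)) (m : ℕ) : Prop :=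
  ∀ τ ∈ T, τ.length = m → approx b (interleave (initSeg f m) τ) 0 ≠ none

/-- Compactness: the strings of `T` on which the computation is still undecided form a tree. If they
occurred at every length, there would be a path of `T` on which `Φ_b` diverges. -/
theorem exists_decided {f : Baire} {b : ℕ} {T : Set (List Bool)} (hT : IsTree T)
    (h : ∀ x ∈ paths T, (Phi b (join f fun n => (x n).toNat) 0).Dom) : ∃ m, Decided f b T m := by
  by_contra hcon
  simp only [Decided, not_exists, not_forall, not_not] at hcon
  set U : Set (List Bool) :=
    {τ | τ ∈ T ∧ approx b (interleave (initSeg f τ.length) τ) 0 = none} with hU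
  have hUT : IsTree U := by
    rintro σ ⟨hσ, hnone⟩ τ hτ
    refine ⟨hT σ hσ τ hτ, ?_⟩
    rw [← initSeg_getD σ false, length_initSeg, interleave_initSeg] at hnone
    have hτ' : τ = initSeg (fun n => σ.getD n false) τ.length := by
      rw [← take_initSeg _ hτ.length_le, initSeg_getD, ← List.prefix_iff_eq_take]
      exact hτ
    rw [hτ', length_initSeg, interleave_initSeg]
    by_contra hne
    obtain ⟨y, hy⟩ := Option.ne_none_iff_exists'.1 hne
    rw [approx_initSeg_mono (Nat.mul_le_mul_left 2 hτ.length_le) hy] at hnone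
    simp at hnone
  obtain ⟨x, hx, -⟩ := exists_mem_paths hUT
    (fun s => by
      obtain ⟨τ, hτ, rfl, hnone⟩ := hcon s
      exact ⟨τ, rfl, hτ, hnone⟩)
    (fun _ => true) 0 (fun j hj => absurd hj (Nat.not_lt_zero j))
  obtain ⟨t, ht⟩ := Phi_dom_iff.1 (h x fun n => (hx n).1)
  obtain ⟨y, hy⟩ := Option.ne_none_iff_exists'.1 ht
  have := (hx t).2
  rw [length_initSeg, interleave_initSeg, approx_initSeg_mono (by omega) hy] at this
  simp at this

/-- A number which codes `b` and `f ↾ m` and exceeds the codes of the strings of length `m`. -/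
def decisionCode (b : ℕ) (l : List ℕ) : ℕ :=
  Nat.pair (codeBound l.length) (Encodable.encode (b, l)) + 1

@[fun_prop] theorem primrec_decisionCode {α : Type*} [Primcodable α] {b : α → ℕ}
    {l : α → List ℕ} (hb : Primrec b) (hl : Primrec l) :
    Primrec (fun a => decisionCode (b a) (l a)) := by
  unfold decisionCode
  fun_prop

theorem codeBound_lt_decisionCode (b : ℕ) (l : List ℕ) :
    codeBound l.length < decisionCode b l :=
  Nat.lt_succ_of_le (Nat.left_le_pair _ _)

open Classical in
/-- Given `⟨⟨f, b⟩, T⟩`, one can compute the least `m` such that `Φ_b(f, x)(0)` is decided by the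
initial segments of length `m`. -/
theorem exists_index_decisionCode : ∃ e, ∀ f b T (h : ∃ m, Decided f b T m),
    Computes e (join (join f (ofNat b)) (codeSet T))
      (join (ofNat (decisionCode b (initSeg f (Nat.find h)))) (codeSet T)) := by
  obtain ⟨e, -, he⟩ := exists_index_computes (α := Unit)
    (fun _ σ n => bif n % 2 == 0 then
      bif n == 0 then firstSome (fun m =>
        (fun l : List ℕ => bif decide (4 * m + 2 < σ.length) &&
          (decide (2 * codeBound m + 1 < σ.length) && (strings m).all fun τ =>
            !(σ.getD (2 * Encodable.encode τ + 1) 0 == 1) ||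
              (approx (σ.getD 2 0) (interleave l τ) 0).isSome)
          then some (decisionCode (σ.getD 2 0) l) else none)
          ((List.range m).map fun j => σ.getD (4 * j) 0)) σ.length
      else some 0
      else σ[n]?) (by fun_prop)
  refine ⟨e (), fun f b T h => ?_⟩
  set q := join (join f (ofNat b)) (codeSet T) with hq
  have hq4 : ∀ j, q (4 * j) = f j := fun j => by
    rw [hq, show 4 * j = 2 * (2 * j) by omega, join_two_mul, join_two_mul]
  have hq2 : q 2 = b := by simp [hq, join, ofNat]
  have hqT : ∀ n, q (2 * n + 1) = codeSet T n := fun n => by rw [hq, join_two_mul_add_one]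
  have key : ∀ t m, ((fun l : List ℕ => bif decide (4 * m + 2 < (initSeg q t).length) &&
      (decide (2 * codeBound m + 1 < (initSeg q t).length) && (strings m).all fun τ =>
        !((initSeg q t).getD (2 * Encodable.encode τ + 1) 0 == 1) ||
          (approx ((initSeg q t).getD 2 0) (interleave l τ) 0).isSome)
      then some (decisionCode ((initSeg q t).getD 2 0) l) else none)
      ((List.range m).map fun j => (initSeg q t).getD (4 * j) 0)) =
      if 4 * m + 2 < t ∧ 2 * codeBound m + 1 < t ∧ Decided f b T m then
        some (decisionCode b (initSeg f m)) else none := by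
    intro t m
    by_cases h1 : 4 * m + 2 < t
    swap
    · simp [h1]
    by_cases h2 : 2 * codeBound m + 1 < t
    swap
    · simp [h2]
    have hl : ((List.range m).map fun j => (initSeg q t).getD (4 * j) 0) = initSeg f m := by
      refine List.map_congr_left fun j hj => ?_
      rw [List.mem_range] at hj
      rw [getD_initSeg _ _ (by omega), hq4]
    have hall : ((strings m).all fun τ =>
        !((initSeg q t).getD (2 * Encodable.encode τ + 1) 0 == 1) ||
          (approx b (interleave (initSeg f m) τ) 0).isSome) = true ↔ Decided f b T m := by
      simp only [List.all_eq_true, mem_strings, Decided, Bool.or_eq_true, Bool.not_eq_true',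
        beq_eq_false_iff_ne, ne_eq, ← imp_iff_not_or, ← Option.isSome_iff_ne_none]
      refine forall_congr' fun τ => ?_
      rw [forall_comm (p := fun (_ : τ ∈ T) (_ : τ.length = m) =>
        (approx b (interleave (initSeg f m) τ) 0).isSome = true)]
      refine forall_congr' fun hτ => ?_
      have := encode_le_codeBound hτ.le
      rw [getD_initSeg _ _ (by omega), hqT, codeSet_encode_eq_one]
    simp only [hl, getD_initSeg q 0 (show 2 < t by omega), hq2, length_initSeg, h1, h2,
      decide_true, Bool.true_and, true_and, Bool.cond_eq_ite, hall]
  refine he _ _ _ (fun n t y hy => ?_) fun n => ?_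
  · obtain ⟨n, rfl | rfl⟩ : ∃ k, n = 2 * k ∨ n = 2 * k + 1 := ⟨n / 2, by omega⟩
    · rw [join_two_mul]
      simp only [Nat.mul_mod_right, beq_self_eq_true, cond_true] at hy
      by_cases hn : n = 0
      · subst hn
        simp only [Nat.mul_zero, beq_self_eq_true, cond_true, key] at hy
        obtain ⟨m, -, hm, hlt⟩ := firstSome_eq_some.1 hy
        split_ifs at hm with hcond
        -- The length tests get easier as `m` decreases, so a smaller decided length would have
        -- passed them and been returned first.
        have hmin : Nat.find h = m := by
          rw [Nat.find_eq_iff]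
          refine ⟨hcond.2.2, fun j hj hdec => ?_⟩
          have hb := codeBound_mono hj.le
          have := hlt j hj
          rw [if_pos ⟨by omega, by omega, hdec⟩] at this
          simp at this
        rw [hmin, ← Option.some.inj hm]
        rfl
      · have : 2 * n ≠ 0 := by omega
        simp only [beq_eq_false_iff_ne.2 this, cond_false, Option.some.injEq] at hy
        rw [← hy, ofNat, if_neg hn]
    · have : (2 * n + 1) % 2 ≠ 0 := by omega
      simp only [beq_eq_false_iff_ne.2 this, cond_false, getElem?_initSeg_eq_some, hqT] at hy
      rw [join_two_mul_add_one, hy.2]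
  · simp only [key]
    by_cases hn : n % 2 = 0
    · by_cases hn0 : n = 0
      · subst hn0
        refine ⟨4 * Nat.find h + 2 * codeBound (Nat.find h) + 3, fun hcon => ?_⟩
        simp only [Nat.zero_mod, beq_self_eq_true, cond_true, firstSome_eq_none,
          length_initSeg] at hcon
        have := hcon (Nat.find h) (by omega)
        rw [if_pos ⟨by omega, by omega, Nat.find_spec h⟩] at this
        simp at this
      · exact ⟨0, by simp [hn, beq_eq_false_iff_ne.2 hn0]⟩
    · refine ⟨n + 1, ?_⟩
      rw [getElem?_initSeg _ (by omega)]
      simp [beq_eq_false_iff_ne.2 hn]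

/-- The `k`-tuple of the instances of `C_2` for the strings with code less than `k`. -/
def branchTuple (k : ℕ) (o : Baire) : Baire :=
  tuple k fun i => branch o ((Encodable.decode (i : ℕ)).getD [])

/-- By `branch_congr`, stage `s` for the string `τ` looks only at codes up to `codeBound (|τ| + s +
1)`. Components whose index decodes to no string ask about the empty string, a harmless extra
instance. -/
theorem exists_index_branchTuple : ∃ e, ∀ k o, Computes e (join (ofNat k) o) (branchTuple k o) := by
  obtain ⟨e, he⟩ := exists_index_of_bound
    (fun σ n => bif n == 0 then σ.getD 0 0 else
      bif decide ((n - 1).unpair.1 < σ.getD 0 0) then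
        branch (fun c => σ.getD (2 * c + 1) 0)
          ((Encodable.decode (n - 1).unpair.1 : Option (List Bool)).getD []) (n - 1).unpair.2
      else 0)
    (fun n => 2 * codeBound (((Encodable.decode (n - 1).unpair.1 :
      Option (List Bool)).getD []).length + (n - 1).unpair.2 + 1) + 1)
    (by fun_prop) (by fun_prop)
  refine ⟨e, fun k o => he _ _ fun n t ht => ?_⟩
  have h0 : join (ofNat k) o 0 = k := by simp [join, ofNat]
  rw [getD_initSeg (n := 0) _ _ (by omega), h0]
  cases n with
  | zero => simp [branchTuple]
  | succ n =>
    simp only [Nat.add_sub_cancel] at ht ⊢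
    by_cases hn : n.unpair.1 < k
    · simp only [hn, decide_true, cond_true, branchTuple, tuple, dif_pos]
      rw [beq_eq_false_iff_ne.2 (Nat.succ_ne_zero n), cond_false]
      refine branch_congr fun c hc => ?_
      rw [getD_initSeg _ _ (by omega), join_two_mul_add_one]
    · simp [hn, branchTuple, tuple]

/-- The bits chosen by the tuple `r` of solutions. -/
def chosenBit (r : Baire) (τ : List Bool) : Bool := r (Nat.pair (Encodable.encode τ) 0 + 1) == 1

/-- The backward functional sees only the solution tuple `r`. Its size `r 0` reveals `b` and `f ↾
m`, and following the chosen bits for `m` steps gives the finite string needed to evaluate the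
observation. -/
theorem exists_index_walk : ∃ e, ∀ (r : Baire) (b : ℕ) (l : List ℕ) (y : ℕ),
    r 0 = decisionCode b l →
    approx b (interleave l (walk (chosenBit r) l.length)) 0 = some y →
    Computes e r (ofNat y) := by
  obtain ⟨e, -, he⟩ := exists_index_computes (α := Unit)
    (fun _ σ n => bif n == 0 then
      bif decide (Nat.pair (σ.getD 0 0) 0 + 1 < σ.length) then
        (Encodable.decode ((σ.getD 0 0 - 1).unpair.2) : Option (ℕ × List ℕ)).bind fun p =>
          approx p.1 (interleave p.2 (walk (fun τ =>
            σ.getD (Nat.pair (Encodable.encode τ) 0 + 1) 0 == 1) p.2.length)) 0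
      else none
      else some 0) (by fun_prop)
  refine ⟨e (), fun r b l y hr hy => ?_⟩
  have key : ∀ t, Nat.pair (r 0) 0 + 1 < t →
      ((Encodable.decode (((initSeg r t).getD 0 0 - 1).unpair.2) : Option (ℕ × List ℕ)).bind
        fun p => approx p.1 (interleave p.2 (walk (fun τ =>
          (initSeg r t).getD (Nat.pair (Encodable.encode τ) 0 + 1) 0 == 1) p.2.length)) 0) =
      some y := by
    intro t ht
    rw [getD_initSeg _ _ (by omega), hr, decisionCode, Nat.add_sub_cancel, Nat.unpair_pair,
      Encodable.encodek, Option.bind_some, ← hy]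
    simp only
    rw [walk_congr (d := chosenBit r) fun j hj => ?_]
    -- Every string met on the walk has a code at most `r 0`, so the bits consulted lie in the part
    -- of `r` already seen.
    have h1 : Encodable.encode (walk (fun τ =>
        (initSeg r t).getD (Nat.pair (Encodable.encode τ) 0 + 1) 0 == 1) j) ≤ r 0 := by
      rw [hr]
      exact (encode_le_codeBound (by simp; omega)).trans (codeBound_lt_decisionCode b l).le
    have h2 := natPair_le_natPair h1 (le_refl 0)
    rw [getD_initSeg _ _ (by omega), chosenBit]
  refine he _ _ _ (fun n t z hz => ?_) fun n => ?_
  · by_cases hn : n = 0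
    · subst hn
      by_cases ht : Nat.pair (r 0) 0 + 1 < t
      · have h0 := key t ht
        rw [getD_initSeg _ _ (by omega)] at h0 hz
        simp only [beq_self_eq_true, cond_true, length_initSeg, ht, decide_true, h0,
          Option.some.injEq] at hz
        simp [← hz, ofNat]
      · by_cases ht0 : 0 < t
        · rw [getD_initSeg _ _ ht0] at hz
          simp [ht] at hz
        · simp [show t = 0 by omega, initSeg] at hz
    · simp only [beq_eq_false_iff_ne.2 hn, cond_false, Option.some.injEq] at hz
      rw [← hz, ofNat, if_neg hn]
  · refine ⟨Nat.pair (r 0) 0 + 2, ?_⟩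
    rw [key _ (by omega), getD_initSeg _ _ (by omega)]
    simp only [length_initSeg, Nat.lt_succ_self, decide_true, cond_true]
    cases n == 0 <;> simp

/-- The tuple has a component for every string of length at most `m`, where `m` is the least decided
length. The walk along the chosen bits starts at the extendible empty string and stays extendible,
so its `m` bits begin a path, and the value computed from them is the observation of that path. -/
theorem observation_WKL_reducible :
    StrongReducible WKL.observation (choice 2).finitePar := by
  classical
  obtain ⟨e₁, he₁⟩ := exists_index_decisionCode
  obtain ⟨e₂, he₂⟩ := exists_index_branchTuple
  obtain ⟨e₃, he₃⟩ := exists_index_walk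
  obtain ⟨s, -, hs⟩ := exists_comp_index
  refine ⟨s (e₁, e₂), e₃, ?_⟩
  rintro _ ⟨f, b, _, rfl, ⟨T, hT, hinf, rfl⟩, hdom⟩
  have hdec := exists_decided (f := f) (b := b) hT fun x hx => hdom _ ⟨T, rfl, x, hx, rfl⟩
  set m := Nat.find hdec with hm
  set k := decisionCode b (initSeg f m) with hk
  refine ⟨branchTuple k (codeSet T),
    ⟨k, _, Nat.succ_pos _, fun i => branch_mem_dom _ _, rfl⟩,
    hs _ _ _ _ _ (he₁ f b T hdec) (he₂ _ _), ?_⟩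
  rintro _ ⟨k', F, G, hF, rfl, hG⟩
  obtain rfl := eq_of_tuple_eq hF
  obtain rfl := tuple_inj.1 hF
  have hlt : ∀ τ : List Bool, τ.length ≤ m → Encodable.encode τ < k := fun τ hτ =>
    (encode_le_codeBound hτ).trans_lt (by
      simpa using codeBound_lt_decisionCode b (initSeg f m))
  -- At each step the current string is shorter than `m`, so its code is below `k` and its component
  -- of the tuple supplies the next bit.
  obtain ⟨x, hx, hxm⟩ := exists_mem_paths hT (extendible_nil hT hinf) (chosenBit (tuple k G)) m
    fun j hj hext => by
      set τ := walk (chosenBit (tuple k G)) j with hτ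
      have hj' := hlt τ (by simp [hτ]; omega)
      have hsol := hG ⟨Encodable.encode τ, hj'⟩
      simp only [Encodable.encodek, Option.getD_some] at hsol
      have := hext.append_of_mem_choice_sol hT hsol
      rwa [← tuple_succ G ⟨_, hj'⟩] at this
  have hmem := hx m
  obtain ⟨y, hy⟩ := Option.ne_none_iff_exists'.1
    (Nat.find_spec hdec (initSeg x m) hmem (length_initSeg x m))
  refine ⟨ofNat y, ⟨f, b, _, rfl, _, ⟨T, rfl, x, hx, rfl⟩, y, ?_, rfl⟩,
    he₃ _ b (initSeg f m) y (tuple_zero _ _) ?_⟩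
  · rw [← hm, interleave_initSeg] at hy
    exact mem_Phi_iff.2 ⟨_, hy⟩
  · rw [length_initSeg, ← hxm]
    exact hy

theorem firstOrderPart_WKL_reducible (n : ℕ) :
    StrongReducible (WKL.iterJump n).firstOrderPart ((choice 2).finitePar.iterJump n) :=
  (firstOrderPart_reducible_observation _).trans
    (observation_iterJump_reducible observation_WKL_reducible n)

end Weihrauch

/-- For every `n`, the first-order parts of `WWKL^(n)` and `WKL^(n)` and the problem `(C_2^*)^(n)`
are strongly Weihrauch equivalent. -/
theorem mainTheorem2 (n : ℕ) :
    Weihrauch.StrongEquiv (Weihrauch.WWKL.iterJump n).firstOrderPart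
        (Weihrauch.WKL.iterJump n).firstOrderPart ∧
      Weihrauch.StrongEquiv (Weihrauch.WKL.iterJump n).firstOrderPart
        ((Weihrauch.choice 2).finitePar.iterJump n) := by
  have h1 := Weihrauch.firstOrderPart_WWKL_reducible n
  have h2 := Weihrauch.firstOrderPart_WKL_reducible n
  have h3 := Weihrauch.iterJump_finitePar_choice_reducible n
  exact ⟨⟨h1, h2.trans h3⟩, h2, h3.trans h1⟩
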